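/- The equation $$\frac{2^{\sigma+1}}{4^{\sigma}-1}\,\log 2=-\frac{\zeta'(\sigma)}{\zeta(\sigma)}$$ has exactly one real solution $\sigma>1$; denote it by $E$. Call $b\in\mathbb{C}\setminus\{1\}$ a turning point of the Riemann zeta function $\zeta$ if $\operatorname{Im}\zeta(b)=0$ and $\operatorname{Re}\zeta'(b)=0$. Then every turning point $b$ of $\zeta$ satisfies $\operatorname{Re} b<E$ (in particular $\operatorname{Re} b\le E$), and there is a sequence $(b_k)$ of turning points of $\zeta$ with $\lim_{k\to\infty}\operatorname{Re} b_k=E$. -/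

import Mathlib

open Filter Topology

/-- A turning point of the Riemann zeta function: a point `b` of its domain `ℂ ∖ {1}` at which
`Im ζ(b) = 0` and `Re ζ'(b) = 0`.  (At the pole Mathlib assigns `ζ` a finite default value, so
`b ≠ 1` is stated.) -/
def IsZetaTurningPoint (b : ℂ) : Prop :=
  b ≠ 1 ∧ (riemannZeta b).im = 0 ∧ (deriv riemannZeta b).re = 0

/-- The real number `σ` is a solution, in the range `σ > 1`, of the equation
`2 ^ (σ + 1) / (4 ^ σ - 1) * log 2 = - ζ'(σ) / ζ(σ)`. -/
def IsTitchmarshSolution (σ : ℝ) : Prop :=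
  1 < σ ∧
    (((2 : ℝ) ^ (σ + 1) / ((4 : ℝ) ^ σ - 1) * Real.log 2 : ℝ) : ℂ) =
      -(deriv riemannZeta (σ : ℂ) / riemannZeta (σ : ℂ))

/-! Isolate the Euler factor at 2. For `1 < re s`, `ζ(s) = G(s) / (1 - z)` with `z = 2 ^ (-s)` and
`G = oddZeta`, so `-ζ'/ζ = P + log 2 * z / (1 - z)` with `P = -G'/G`. Where `ζ` is real it is also
nonzero, so `re ζ' = 0` means that the real parts of the two summands cancel. Put `r = |z| = 2 ^
(-σ)` and let `D(σ)` be the value of `P` on the real axis. Then `|re P| ≤ D(σ)`, while the least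
value of `re (z / (1 - z))` on the circle is `-r / (1 + r)`, taken at `z = -r`. By partial fractions
the equation for `E` says exactly `D(E) = log 2 * r / (1 + r)`. Since `(1 + 2 ^ σ) * D(σ)` is
strictly decreasing, `E` is unique; comparison with `log 2` gives `E > 5/2`.

No turning point has `re b ≥ E`. Away from `z = ±r` the quantity `|re (z / (1 - z))|` can be small,
but reality of `ζ` then forces `α = arg G` away from multiples of π, and a nonzero `α` costs `|re
P|` at least `α ^ 2 * log 2 / r` (`abs_re_oddLogDeriv_add_le`). The optimization
`lt_abs_re_div_one_sub` shows that this cost suffices: `|re P| < log 2 * |re (z / (1 - z))|` off the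
real axis (`abs_re_oddLogDeriv_lt_of_im_eq_zero`).

Turning points approach `E`. By Kronecker's theorem some translates `ζ(s + iT)` are uniformly close
to `zetaTwist (-1)`, the Euler product with the sign at 2 reversed. Just left of `E` the imaginary
part of this limit decreases vertically through the real axis. For `ζ` itself, on the line `re s =
E` at the corresponding heights, every zero of the imaginary part is increasing. A decreasing zero
therefore has to disappear between the two lines, and it does so at a turning point
(`exists_im_eq_zero_re_deriv_eq_zero`). -/

/-! ### Kronecker's theorem by mean values, and independence of the logarithms of primes -/

section Kronecker

open Complex in
/-- The mean value of `t ↦ exp (i μ t)` over `[0, T]` tends to `0` unless `μ = 0`. -/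
theorem tendsto_mean_exp (μ : ℝ) :
    Tendsto (fun T : ℝ => (T : ℂ)⁻¹ * ∫ t in (0 : ℝ)..T, exp ((μ * I) * t)) atTop
      (𝓝 (if μ = 0 then 1 else 0)) := by
  split_ifs with h
  · refine tendsto_const_nhds.congr' ?_
    filter_upwards [eventually_gt_atTop 0] with T hT
    have : (T : ℂ) ≠ 0 := by exact_mod_cast hT.ne'
    simp [h, this]
  · have hc : (μ * I : ℂ) ≠ 0 := mul_ne_zero (by exact_mod_cast h) I_ne_zero
    rw [tendsto_zero_iff_norm_tendsto_zero]
    have hlim : Tendsto (fun T : ℝ => T⁻¹ * (2 / |μ|)) atTop (𝓝 0) := by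
      simpa using tendsto_inv_atTop_zero.mul_const (2 / |μ|)
    refine squeeze_zero' (Eventually.of_forall fun T => norm_nonneg _) ?_ hlim
    filter_upwards [eventually_gt_atTop 0] with T hT
    rw [integral_exp_mul_complex hc, norm_mul, norm_div, norm_inv, norm_real, Real.norm_eq_abs,
      abs_of_pos hT]
    have h1 : ‖exp (μ * I * T) - exp (μ * I * (0 : ℝ))‖ ≤ 2 := by
      refine (norm_sub_le _ _).trans ?_
      have h2 : ‖exp (μ * I * T)‖ = 1 := by
        rw [show (μ * I * T : ℂ) = ((μ * T : ℝ) : ℂ) * I by push_cast; ring, norm_exp_ofReal_mul_I]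
      rw [h2]; norm_num
    have h3 : ‖(μ * I : ℂ)‖ = |μ| := by simp
    rw [h3]
    gcongr

open Complex ComplexConjugate in
/-- Bessel inequality for bounded generalized trigonometric polynomials. -/
theorem sum_norm_sq_le_of_trigPoly_bound {κ : Type*} [Fintype κ] (ν : κ → ℝ)
    (hν : Function.Injective ν) (c : κ → ℂ) {M : ℝ}
    (hM : ∀ t : ℝ, ‖∑ j, c j * exp ((ν j * I) * t)‖ ^ 2 ≤ M) :
    ∑ j, ‖c j‖ ^ 2 ≤ M := by
  classical
  have hexp (t : ℝ) : ((‖∑ j, c j * exp ((ν j * I) * t)‖ ^ 2 : ℝ) : ℂ) =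
      ∑ j, ∑ k, c j * conj (c k) * exp (((ν j - ν k : ℝ) * I) * t) := by
    rw [← normSq_eq_norm_sq, ← mul_conj, map_sum, Finset.sum_mul_sum]
    refine Finset.sum_congr rfl fun j _ => Finset.sum_congr rfl fun k _ => ?_
    rw [map_mul, ← exp_conj]
    have : exp (((ν j - ν k : ℝ) * I) * t) = exp ((ν j * I) * t) * exp (conj ((ν k * I) * t)) := by
      rw [← exp_add]; congr 1; simp; ring
    rw [this]; ring
  have hint (T : ℝ) : ((T⁻¹ * ∫ t in (0 : ℝ)..T, ‖∑ j, c j * exp ((ν j * I) * t)‖ ^ 2 : ℝ) : ℂ) =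
      ∑ j, ∑ k, c j * conj (c k) *
        ((T : ℂ)⁻¹ * ∫ t in (0 : ℝ)..T, exp (((ν j - ν k : ℝ) * I) * t)) := by
    push_cast
    rw [← intervalIntegral.integral_ofReal]
    simp_rw [hexp]
    rw [intervalIntegral.integral_finsetSum fun j _ => Continuous.intervalIntegrable
      (by fun_prop) _ _, Finset.mul_sum]
    refine Finset.sum_congr rfl fun j _ => ?_
    rw [intervalIntegral.integral_finsetSum fun j _ => Continuous.intervalIntegrable
      (by fun_prop) _ _, Finset.mul_sum]
    refine Finset.sum_congr rfl fun k _ => ?_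
    rw [intervalIntegral.integral_const_mul]
    push_cast
    ring
  have hlim : Tendsto (fun T : ℝ => ∑ j, ∑ k, c j * conj (c k) *
        ((T : ℂ)⁻¹ * ∫ t in (0 : ℝ)..T, exp (((ν j - ν k : ℝ) * I) * t))) atTop
      (𝓝 (∑ j, ∑ k, c j * conj (c k) * (if ν j - ν k = 0 then 1 else 0))) :=
    tendsto_finsetSum _ fun j _ => tendsto_finsetSum _ fun k _ =>
      (tendsto_mean_exp _).const_mul _
  have hval : ∑ j, ∑ k, c j * conj (c k) * (if ν j - ν k = 0 then 1 else 0) =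
      ((∑ j, ‖c j‖ ^ 2 : ℝ) : ℂ) := by
    push_cast
    refine Finset.sum_congr rfl fun j _ => ?_
    simp_rw [sub_eq_zero, hν.eq_iff]
    simp [mul_conj, normSq_eq_norm_sq]
  rw [hval] at hlim
  simp_rw [← hint] at hlim
  have hlim' := (continuous_re.tendsto _).comp hlim
  simp only [Function.comp_def, ofReal_re] at hlim'
  refine le_of_tendsto hlim' ?_
  filter_upwards [eventually_gt_atTop 0] with T hT
  rw [inv_mul_le_iff₀ hT]
  calc _ ≤ ∫ t in (0 : ℝ)..T, M :=
        intervalIntegral.integral_mono_on hT.le (Continuous.intervalIntegrable (by fun_prop) _ _)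
          (by simp) fun t _ => hM t
    _ = T * M := by simp

open Complex ComplexConjugate in
/-- **Kronecker's approximation theorem**: if the reals `ν i` are linearly independent over `ℤ`,
the line `t ↦ (exp (i ν i t))` is dense in the torus. -/
theorem kronecker_approximation {ι : Type*} [Fintype ι] (ν : ι → ℝ)
    (hν : ∀ m : ι → ℤ, ∑ i, m i * ν i = 0 → m = 0) (z : ι → ℂ) (hz : ∀ i, ‖z i‖ = 1)
    {ε : ℝ} (hε : 0 < ε) : ∃ t : ℝ, ∀ i, ‖exp ((ν i * I) * t) - z i‖ < ε := by
  classical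
  by_contra! hcon
  have hunit (i : ι) (t : ℝ) : ‖exp ((ν i * I) * t)‖ = 1 := by
    rw [show (ν i * I * t : ℂ) = ((ν i * t : ℝ) : ℂ) * I by push_cast; ring, norm_exp_ofReal_mul_I]
  have hpar (i : ι) (t : ℝ) : ‖(z i + exp ((ν i * I) * t)) / 2‖ ^ 2 =
      1 - ‖exp ((ν i * I) * t) - z i‖ ^ 2 / 4 := by
    have := parallelogram_law_with_norm ℝ (exp ((ν i * I) * t)) (z i)
    rw [hunit, hz] at this
    rw [norm_div, div_pow, add_comm (z i), RCLike.norm_ofNat]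
    linarith
  obtain ⟨i₀, -⟩ := hcon 0
  -- At every `t` some coordinate is `ε`-far from its target, so by the parallelogram law its
  -- midpoint factor has squared norm at most `1 - ε ^ 2 / 4`. The maximum with 0 covers `ε > 2`.
  set ρ : ℝ := max (1 - ε ^ 2 / 4) 0 with hρ
  have hρ0 : 0 ≤ ρ := le_max_right _ _
  have hρ1 : ρ < 1 := max_lt (by have := pow_pos hε 2; linarith) one_pos
  have hprod (t : ℝ) : ∏ i, ‖(z i + exp ((ν i * I) * t)) / 2‖ ^ 2 ≤ ρ := by
    obtain ⟨i, hi⟩ := hcon t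
    rw [← Finset.mul_prod_erase _ _ (Finset.mem_univ i)]
    have h1 : ‖(z i + exp ((ν i * I) * t)) / 2‖ ^ 2 ≤ ρ := by
      rw [hpar]
      refine le_trans ?_ (le_max_left _ _)
      have := pow_le_pow_left₀ hε.le hi 2
      linarith
    have h2 : ∏ j ∈ Finset.univ.erase i, ‖(z j + exp ((ν j * I) * t)) / 2‖ ^ 2 ≤ 1 :=
      Finset.prod_le_one (fun j _ => by positivity) fun j _ => by
        rw [hpar]; have := sq_nonneg ‖exp ((ν j * I) * t) - z j‖; linarith
    calc _ ≤ ρ * 1 := mul_le_mul h1 h2 (Finset.prod_nonneg fun j _ => by positivity) hρ0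
      _ = ρ := mul_one _
  -- Expand the `N`-th power of the product of midpoints. By independence the frequencies are
  -- distinct, the moduli of the coefficients are binomial weights of sum 1, and there are `(N + 1)
  -- ^ card ι` of them. Cauchy–Schwarz and Bessel give the bound, which fails for large `N` because
  -- `ρ < 1`.
  have key (N : ℕ) : 1 ≤ ((N + 1 : ℕ) : ℝ) ^ Fintype.card ι * ρ ^ N := by
    let a : (ι → Fin (N + 1)) → ℂ := fun e =>
      ∏ i, (z i ^ (N - (e i : ℕ)) * (N.choose (e i)) / 2 ^ N)
    let μ : (ι → Fin (N + 1)) → ℝ := fun e => ∑ i, ((e i : ℕ) : ℝ) * ν i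
    have hμ : Function.Injective μ := by
      intro e e' h
      have h0 : ∑ i, (((e i : ℕ) : ℤ) - ((e' i : ℕ) : ℤ) : ℤ) * ν i = 0 := by
        have : ∑ i, (((e i : ℕ) : ℤ) - ((e' i : ℕ) : ℤ) : ℤ) * ν i = μ e - μ e' := by
          simp only [μ, ← Finset.sum_sub_distrib]
          refine Finset.sum_congr rfl fun i _ => ?_
          push_cast; ring
        rw [this, h, sub_self]
      have h1 := hν _ h0
      ext i
      have := congrFun h1 i
      simp only [Pi.zero_apply] at this
      omega
    have hsum (t : ℝ) : ∑ e, a e * exp ((μ e * I) * t) =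
        ∏ i, ((z i + exp ((ν i * I) * t)) / 2) ^ N := by
      have h1 (i : ι) : ((z i + exp ((ν i * I) * t)) / 2) ^ N = ∑ k : Fin (N + 1),
          (z i ^ (N - (k : ℕ)) * (N.choose k) / 2 ^ N) * exp (((k : ℕ) * ν i * I) * t) := by
        rw [div_pow, add_comm, add_pow, Finset.sum_range, Finset.sum_div]
        refine Finset.sum_congr rfl fun k _ => ?_
        rw [← exp_nat_mul]
        rw [show ((k : ℕ) * (ν i * I * t) : ℂ) = ((k : ℕ) * ν i * I) * t by ring]
        ring
      simp_rw [h1]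
      rw [Finset.prod_univ_sum]
      simp only [Fintype.piFinset_univ]
      refine Finset.sum_congr rfl fun e _ => ?_
      rw [Finset.prod_mul_distrib, ← exp_sum]
      congr 2
      simp only [μ]; push_cast
      rw [Finset.sum_mul, Finset.sum_mul]
    have hb (t : ℝ) : ‖∑ e, a e * exp ((μ e * I) * t)‖ ^ 2 ≤ ρ ^ N := by
      rw [hsum, Finset.prod_pow, norm_pow, ← pow_mul, mul_comm, pow_mul, norm_prod,
        ← Finset.prod_pow]
      exact pow_le_pow_left₀ (Finset.prod_nonneg fun j _ => by positivity) (hprod t) N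
    have hB := sum_norm_sq_le_of_trigPoly_bound μ hμ a hb
    have hone : ∑ e, ‖a e‖ = 1 := by
      have h1 (e : ι → Fin (N + 1)) : ‖a e‖ = ∏ i, ((N.choose (e i) : ℝ) / 2 ^ N) := by
        simp only [a, norm_prod]
        refine Finset.prod_congr rfl fun i _ => ?_
        simp [hz]
      simp_rw [h1]
      rw [← Fintype.piFinset_univ, ← Finset.prod_univ_sum (fun _ : ι => Finset.univ)
        (fun _ (k : Fin (N + 1)) => (N.choose k : ℝ) / 2 ^ N)]
      refine Finset.prod_eq_one fun i _ => ?_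
      rw [← Finset.sum_div, ← Finset.sum_range (fun k => (N.choose k : ℝ))]
      have := Nat.sum_range_choose N
      rw [div_eq_one_iff_eq (by positivity)]
      exact_mod_cast this
    have hCS : (∑ e, ‖a e‖) ^ 2 ≤ (Finset.univ : Finset (ι → Fin (N + 1))).card *
        ∑ e, ‖a e‖ ^ 2 := sq_sum_le_card_mul_sum_sq
    rw [hone, one_pow, Finset.card_univ, Fintype.card_fun, Fintype.card_fin] at hCS
    refine hCS.trans ?_
    push_cast
    gcongr
  have hlim : Tendsto (fun N : ℕ => ((N + 1 : ℕ) : ℝ) ^ Fintype.card ι * ρ ^ (N + 1)) atTop (𝓝 0) :=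
    (tendsto_pow_const_mul_const_pow_of_abs_lt_one (Fintype.card ι)
      (by rwa [abs_of_nonneg hρ0])).comp (tendsto_add_atTop_nat 1)
  have hle (N : ℕ) : ρ ≤ ((N + 1 : ℕ) : ℝ) ^ Fintype.card ι * ρ ^ (N + 1) := by
    have := mul_le_mul_of_nonneg_right (key N) hρ0
    rw [one_mul] at this
    rw [pow_succ, ← mul_assoc]; exact this
  have hρz : ρ = 0 := le_antisymm (ge_of_tendsto' hlim hle) hρ0
  have := key 1
  rw [hρz] at this
  norm_num at this

/-- Logarithms of distinct primes are linearly independent over `ℤ`. -/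
theorem sum_int_mul_log_prime_eq_zero (S : Finset ℕ) (hS : ∀ p ∈ S, p.Prime) (m : S → ℤ)
    (h : ∑ p, m p * Real.log (p : ℕ) = 0) : m = 0 := by
  classical
  have hpos (p : S) : 0 < ((p : ℕ) : ℝ) := by exact_mod_cast (hS p p.2).pos
  -- Moving the negative coefficients to the other side gives two equal products of prime powers, to
  -- be compared by unique factorization.
  have h1 : ∑ p : S, ((m p).toNat : ℝ) * Real.log (p : ℕ) =
      ∑ p : S, ((-m p).toNat : ℝ) * Real.log (p : ℕ) := by
    rw [← sub_eq_zero, ← Finset.sum_sub_distrib, ← h]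
    refine Finset.sum_congr rfl fun p _ => ?_
    rw [← sub_mul]
    congr 1
    have := Int.toNat_sub_toNat_neg (m p)
    exact_mod_cast this
  have h2 (k : S → ℕ) : ∑ p : S, (k p : ℝ) * Real.log (p : ℕ) =
      Real.log ((∏ p : S, (p : ℕ) ^ k p : ℕ) : ℝ) := by
    push_cast
    rw [Real.log_prod fun p _ => (pow_pos (hpos p) _).ne']
    simp
  rw [h2, h2] at h1
  have hp (k : S → ℕ) : 0 < ∏ p : S, (p : ℕ) ^ k p :=
    Finset.prod_pos fun p _ => pow_pos (hS p p.2).pos _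
  have h3 : ∏ p : S, (p : ℕ) ^ (m p).toNat = ∏ p : S, (p : ℕ) ^ (-m p).toNat := by
    have := Real.log_injOn_pos (Set.mem_Ioi.2 (by exact_mod_cast hp _))
      (Set.mem_Ioi.2 (by exact_mod_cast hp _)) h1
    exact_mod_cast this
  have h4 (k : S → ℕ) (q : S) : (∏ p : S, (p : ℕ) ^ k p).factorization q = k q := by
    rw [Nat.factorization_prod fun (p : S) _ => (pow_pos (hS p p.2).pos _).ne']
    rw [Finsupp.finsetSum_apply, Finset.sum_eq_single q]
    · simp [(hS q q.2).factorization_self]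
    · intro p _ hpq
      rw [(hS p p.2).factorization_pow, Finsupp.single_apply, if_neg]
      exact fun h => hpq (Subtype.ext h)
    · simp
  ext q
  have := h4 (fun p => (m p).toNat) q
  rw [h3, h4] at this
  simp only [Pi.zero_apply]
  omega

end Kronecker

/-! ### The Euler product without the prime 2, its logarithm and logarithmic derivative -/

section Decomposition

/-- The von Mangoldt function restricted to odd integers. -/
noncomputable def oddMangoldt (n : ℕ) : ℝ := if Even n then 0 else ArithmeticFunction.vonMangoldt n

theorem oddMangoldt_nonneg (n : ℕ) : 0 ≤ oddMangoldt n := by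
  unfold oddMangoldt; split_ifs
  exacts [le_rfl, ArithmeticFunction.vonMangoldt_nonneg]

theorem oddMangoldt_le_log (n : ℕ) : oddMangoldt n ≤ Real.log n := by
  unfold oddMangoldt; split_ifs
  exacts [Real.log_natCast_nonneg n, ArithmeticFunction.vonMangoldt_le_log]

theorem oddMangoldt_of_even {n : ℕ} (h : Even n) : oddMangoldt n = 0 := if_pos h

theorem oddMangoldt_eq_zero_of_lt {n : ℕ} (h : n < 3) : oddMangoldt n = 0 := by
  interval_cases n <;> simp [oddMangoldt]

theorem oddMangoldt_prime {p : ℕ} (hp : p.Prime) (h2 : p ≠ 2) : oddMangoldt p = Real.log p := by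
  rw [oddMangoldt, if_neg, ArithmeticFunction.vonMangoldt_apply_prime hp]
  rw [Nat.not_even_iff_odd]
  exact hp.odd_of_ne_two h2

theorem trivChar_two_apply (n : ℕ) :
    (1 : DirichletCharacter ℂ 2) n = if Even n then 0 else 1 := by
  split_ifs with h
  · refine MulChar.map_nonunit _ ?_
    rw [ZMod.isUnit_iff_coprime]
    simpa [Nat.coprime_two_right, Nat.not_odd_iff_even] using h
  · refine MulChar.one_apply ?_
    rw [ZMod.isUnit_iff_coprime]
    simpa [Nat.coprime_two_right, Nat.not_even_iff_odd] using h

open LSeries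

/-- The zeta function with its Euler factor at `2` removed. -/
noncomputable def oddZeta (s : ℂ) : ℂ := (1 - 2 ^ (-s)) * riemannZeta s

theorem oddZeta_eq_LSeries {s : ℂ} (hs : 1 < s.re) :
    oddZeta s = LSeries ((1 : DirichletCharacter ℂ 2) ·) s := by
  have h1 : s ≠ 1 := by rintro rfl; simp at hs
  rw [← DirichletCharacter.LFunction_eq_LSeries _ hs]
  have := DirichletCharacter.LFunctionTrivChar_eq_mul_riemannZeta (N := 2) h1
  rw [DirichletCharacter.LFunctionTrivChar] at this
  rw [this, Nat.prime_two.primeFactors]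
  simp [oddZeta]

theorem isOpen_one_lt_re : IsOpen {s : ℂ | 1 < s.re} := isOpen_lt continuous_const Complex.continuous_re

/-- The Dirichlet series of `oddMangoldt`. -/
noncomputable def oddLogDeriv (s : ℂ) : ℂ := LSeries (fun n => (oddMangoldt n : ℂ)) s

/-- The Dirichlet series of `oddMangoldt n / log n`, a logarithm of `oddZeta`. -/
noncomputable def oddLog (s : ℂ) : ℂ := LSeries (fun n => (oddMangoldt n / Real.log n : ℝ)) s

theorem twist_mangoldt_eq : ((fun n : ℕ => (1 : DirichletCharacter ℂ 2) n) * fun n : ℕ =>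
    (ArithmeticFunction.vonMangoldt n : ℂ)) = fun n => (oddMangoldt n : ℂ) := by
  ext n
  simp only [Pi.mul_apply, trivChar_two_apply, oddMangoldt]
  split_ifs <;> simp

theorem LSeriesSummable_oddMangoldt {s : ℂ} (hs : 1 < s.re) :
    LSeriesSummable (fun n => (oddMangoldt n : ℂ)) s := by
  rw [← twist_mangoldt_eq]
  exact DirichletCharacter.LSeriesSummable_twist_vonMangoldt _ hs

theorem abscissa_oddMangoldt_le : abscissaOfAbsConv (fun n => (oddMangoldt n : ℂ)) ≤ 1 :=
  abscissaOfAbsConv_le_of_forall_lt_LSeriesSummable fun y hy =>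
    LSeriesSummable_oddMangoldt (by simpa using hy)

theorem abs_oddMangoldt_div_log_le (n : ℕ) : |oddMangoldt n / Real.log n| ≤ 1 := by
  rw [abs_of_nonneg (div_nonneg (oddMangoldt_nonneg n) (Real.log_natCast_nonneg n))]
  exact div_le_one_of_le₀ (oddMangoldt_le_log n) (Real.log_natCast_nonneg n)

theorem abscissa_oddMangoldt_div_log_le :
    abscissaOfAbsConv (fun n => ((oddMangoldt n / Real.log n : ℝ) : ℂ)) ≤ 1 :=
  abscissaOfAbsConv_le_of_le_const ⟨1, fun n _ => by
    rw [Complex.norm_real]; exact abs_oddMangoldt_div_log_le n⟩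

theorem LSeriesSummable_oddMangoldt_div_log {s : ℂ} (hs : 1 < s.re) :
    LSeriesSummable (fun n => ((oddMangoldt n / Real.log n : ℝ) : ℂ)) s :=
  LSeriesSummable_of_abscissaOfAbsConv_lt_re
    (abscissa_oddMangoldt_div_log_le.trans_lt (by exact_mod_cast hs))

theorem oddZeta_ne_zero {s : ℂ} (hs : 1 < s.re) : oddZeta s ≠ 0 := by
  rw [oddZeta_eq_LSeries hs]
  exact DirichletCharacter.LSeries_ne_zero_of_one_lt_re _ hs

theorem hasDerivAt_oddZeta {s : ℂ} (hs : 1 < s.re) :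
    HasDerivAt oddZeta (-oddLogDeriv s * oddZeta s) s := by
  have hne : LSeries ((1 : DirichletCharacter ℂ 2) ·) s ≠ 0 :=
    DirichletCharacter.LSeries_ne_zero_of_one_lt_re _ hs
  have h1 := DirichletCharacter.LSeries_twist_vonMangoldt_eq (1 : DirichletCharacter ℂ 2) hs
  rw [twist_mangoldt_eq, eq_div_iff hne] at h1
  have habs : abscissaOfAbsConv ((1 : DirichletCharacter ℂ 2) ·) < s.re := by
    rw [DirichletCharacter.absicssaOfAbsConv_eq_one two_ne_zero]; exact_mod_cast hs
  have h2 := (LSeries_hasDerivAt habs).differentiableAt.hasDerivAt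
  have h3 : deriv (LSeries ((1 : DirichletCharacter ℂ 2) ·)) s = -oddLogDeriv s * oddZeta s := by
    rw [oddZeta_eq_LSeries hs, oddLogDeriv, neg_mul, h1, neg_neg]
  rw [h3] at h2
  refine h2.congr_of_eventuallyEq ?_
  filter_upwards [isOpen_one_lt_re.mem_nhds hs] with z hz using oddZeta_eq_LSeries hz

theorem hasDerivAt_oddLog {s : ℂ} (hs : 1 < s.re) : HasDerivAt oddLog (-oddLogDeriv s) s := by
  have h := LSeries_hasDerivAt (f := fun n => ((oddMangoldt n / Real.log n : ℝ) : ℂ)) (s := s)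
    (abscissa_oddMangoldt_div_log_le.trans_lt (by exact_mod_cast hs))
  convert! h using 2
  refine LSeries_congr (fun {n} hn => ?_) s
  rw [logMul, ← Complex.natCast_log, ← Complex.ofReal_mul]
  -- Where `log n = 0` the quotient is 0 by convention; nothing is lost, since `oddMangoldt n ≤ log
  -- n`.
  rcases eq_or_ne (Real.log n) 0 with h0 | h0
  · have : oddMangoldt n = 0 :=
      le_antisymm ((oddMangoldt_le_log n).trans h0.le) (oddMangoldt_nonneg n)
    simp [this]
  · rw [mul_div_cancel₀ _ h0]

/-- The product `oddZeta * exp (-oddLog)` has zero derivative on a connected half-plane and tends to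
1 along the positive real axis. -/
theorem exp_oddLog {s : ℂ} (hs : 1 < s.re) : Complex.exp (oddLog s) = oddZeta s := by
  have hder (z : ℂ) (hz : z ∈ {s : ℂ | 1 < s.re}) :
      HasDerivAt (fun z => oddZeta z * Complex.exp (-oddLog z)) 0 z := by
    convert! (hasDerivAt_oddZeta hz).mul (hasDerivAt_oddLog hz).fun_neg.cexp using 1
    ring
  have hconv : Convex ℝ {s : ℂ | 1 < s.re} := convex_halfSpace_re_gt 1
  have hconst (x : ℂ) (hx : 1 < x.re) : oddZeta x * Complex.exp (-oddLog x) =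
      oddZeta s * Complex.exp (-oddLog s) :=
    isOpen_one_lt_re.is_const_of_deriv_eq_zero hconv.isPreconnected
      (fun z hz => (hder z hz).differentiableAt.differentiableWithinAt)
      (fun z hz => (hder z hz).deriv) hx hs
  have hlim1 : Tendsto (fun x : ℝ => oddLog x) atTop (𝓝 0) := by
    have := LSeries.tendsto_atTop (f := fun n => ((oddMangoldt n / Real.log n : ℝ) : ℂ))
      (abscissa_oddMangoldt_div_log_le.trans_lt (EReal.coe_lt_top 1))
    rwa [oddMangoldt_eq_zero_of_lt (by norm_num), zero_div, Complex.ofReal_zero] at this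
  have hlim2 : Tendsto (fun x : ℝ => oddZeta x) atTop (𝓝 1) := by
    have := LSeries.tendsto_atTop (f := ((1 : DirichletCharacter ℂ 2) ·))
      (by rw [DirichletCharacter.absicssaOfAbsConv_eq_one two_ne_zero]; exact EReal.coe_lt_top 1)
    simp only [trivChar_two_apply 1] at this
    norm_num at this
    refine this.congr' ?_
    filter_upwards [eventually_gt_atTop 1] with x hx
    rw [oddZeta_eq_LSeries (by simpa using hx)]
  have hlim := hlim2.mul ((Complex.continuous_exp.tendsto _).comp hlim1.neg)
  have hlim' : Tendsto (fun x : ℝ => oddZeta x * Complex.exp (-oddLog x)) atTop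
      (𝓝 (oddZeta s * Complex.exp (-oddLog s))) := by
    refine tendsto_const_nhds.congr' ?_
    filter_upwards [eventually_gt_atTop 1] with x hx
    rw [hconst x (by simpa using hx)]
  have heq := tendsto_nhds_unique hlim' hlim
  rw [neg_zero, Complex.exp_zero, mul_one, Complex.exp_neg,
    mul_inv_eq_one₀ (Complex.exp_ne_zero _)] at heq
  exact heq.symm

/-- Real and imaginary parts of the terms of a Dirichlet series with real coefficients. -/
theorem term_ofReal_eq (w : ℕ → ℝ) (h0 : w 0 = 0) (σ t : ℝ) (n : ℕ) :
    term (fun n => (w n : ℂ)) (σ + t * Complex.I) n =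
      ((w n * (n : ℝ) ^ (-σ) * Real.cos (t * Real.log n) : ℝ) : ℂ) +
      ((-(w n * (n : ℝ) ^ (-σ) * Real.sin (t * Real.log n)) : ℝ) : ℂ) * Complex.I := by
  rcases Nat.eq_zero_or_pos n with rfl | hn
  · simp [h0]
  have hn' : (n : ℂ) ≠ 0 := by exact_mod_cast hn.ne'
  have hn'' : (0 : ℝ) < n := by exact_mod_cast hn
  rw [term_def₀ (by simpa using h0)]
  have : (n : ℂ) ^ (-(σ + t * Complex.I)) = ((n : ℝ) ^ (-σ) : ℝ) *
      (Complex.cos (t * Real.log n) - Complex.sin (t * Real.log n) * Complex.I) := by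
    rw [neg_add, Complex.cpow_add _ _ hn', Complex.ofReal_cpow hn''.le]
    push_cast
    congr 1
    rw [Complex.cpow_def_of_ne_zero hn', ← Complex.natCast_log,
      show (Real.log n : ℂ) * -(t * Complex.I) = (-(t * Real.log n)) * Complex.I by ring,
      Complex.exp_mul_I, Complex.cos_neg, Complex.sin_neg]
    ring
  rw [this]
  push_cast
  ring

theorem hasSum_re_LSeries (w : ℕ → ℝ) (h0 : w 0 = 0) {σ t : ℝ}
    (h : LSeriesSummable (fun n => (w n : ℂ)) (σ + t * Complex.I)) :
    HasSum (fun n : ℕ => w n * (n : ℝ) ^ (-σ) * Real.cos (t * Real.log n))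
      (LSeries (fun n => (w n : ℂ)) (σ + t * Complex.I)).re := by
  convert! Complex.hasSum_re h.hasSum using 2 with n
  rw [term_ofReal_eq w h0]
  simp only [Complex.add_re, Complex.ofReal_re, Complex.re_ofReal_mul, Complex.I_re]
  ring

theorem hasSum_im_LSeries (w : ℕ → ℝ) (h0 : w 0 = 0) {σ t : ℝ}
    (h : LSeriesSummable (fun n => (w n : ℂ)) (σ + t * Complex.I)) :
    HasSum (fun n : ℕ => -(w n * (n : ℝ) ^ (-σ) * Real.sin (t * Real.log n)))
      (LSeries (fun n => (w n : ℂ)) (σ + t * Complex.I)).im := by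
  convert! Complex.hasSum_im h.hasSum using 2 with n
  rw [term_ofReal_eq w h0]
  simp only [Complex.add_im, Complex.ofReal_im, Complex.im_ofReal_mul, Complex.I_im]
  ring

end Decomposition

/-! ### The Euler factor at 2 dominates where the function is real -/

section KeyInequality

/-- The value of `oddLogDeriv` on the real axis. -/
noncomputable def oddLogDerivReal (σ : ℝ) : ℝ := ∑' n : ℕ, oddMangoldt n * (n : ℝ) ^ (-σ)

theorem summable_oddMangoldt_mul_rpow {σ : ℝ} (hσ : 1 < σ) :
    Summable fun n : ℕ => oddMangoldt n * (n : ℝ) ^ (-σ) := by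
  have := hasSum_re_LSeries oddMangoldt (oddMangoldt_eq_zero_of_lt (by norm_num)) (σ := σ) (t := 0)
    (LSeriesSummable_oddMangoldt (by simpa using hσ))
  simpa using this.summable

theorem oddMangoldt_mul_rpow_nonneg (σ : ℝ) (n : ℕ) : 0 ≤ oddMangoldt n * (n : ℝ) ^ (-σ) :=
  mul_nonneg (oddMangoldt_nonneg n) (Real.rpow_nonneg n.cast_nonneg _)

theorem oddLogDerivReal_nonneg (σ : ℝ) : 0 ≤ oddLogDerivReal σ :=
  tsum_nonneg (oddMangoldt_mul_rpow_nonneg σ)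

theorem hasSum_re_oddLogDeriv {σ : ℝ} (hσ : 1 < σ) (t : ℝ) :
    HasSum (fun n : ℕ => oddMangoldt n * (n : ℝ) ^ (-σ) * Real.cos (t * Real.log n))
      (oddLogDeriv (σ + t * Complex.I)).re :=
  hasSum_re_LSeries oddMangoldt (oddMangoldt_eq_zero_of_lt (by norm_num))
    (LSeriesSummable_oddMangoldt (by simpa using hσ))

theorem hasSum_im_oddLog {σ : ℝ} (hσ : 1 < σ) (t : ℝ) :
    HasSum (fun n : ℕ => -(oddMangoldt n / Real.log n * (n : ℝ) ^ (-σ) * Real.sin (t * Real.log n)))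
      (oddLog (σ + t * Complex.I)).im :=
  hasSum_im_LSeries (fun n => oddMangoldt n / Real.log n)
    (by simp) (LSeriesSummable_oddMangoldt_div_log (by simpa using hσ))

theorem oddLogDeriv_ofReal {σ : ℝ} (hσ : 1 < σ) : oddLogDeriv σ = oddLogDerivReal σ := by
  have hs : LSeriesSummable (fun n => (oddMangoldt n : ℂ)) (σ + (0 : ℝ) * Complex.I) :=
    LSeriesSummable_oddMangoldt (by simpa using hσ)
  have hre := hasSum_re_oddLogDeriv hσ 0
  have him := hasSum_im_LSeries oddMangoldt (oddMangoldt_eq_zero_of_lt (by norm_num)) hs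
  simp only [zero_mul, Real.cos_zero, mul_one, Real.sin_zero, mul_zero, neg_zero,
    Complex.ofReal_zero, add_zero] at hre him
  refine Complex.ext ?_ ?_
  · rw [Complex.ofReal_re]; exact hre.tsum_eq.symm
  · rw [Complex.ofReal_im]; exact him.unique hasSum_zero

theorem hasSum_odd_ge_three_inv_sq :
    HasSum (fun n : ℕ => if Even n ∨ n < 3 then (0 : ℝ) else 1 / (n : ℝ) ^ 2)
      (Real.pi ^ 2 / 8 - 1) := by
  have heven : HasSum (fun n : ℕ => if Even n then 1 / (n : ℝ) ^ 2 else 0) (Real.pi ^ 2 / 24) := by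
    refine (Function.Injective.hasSum_iff (g := fun k : ℕ => 2 * k)
      (fun a b h => by simpa using h) fun n hn => ?_).1 ?_
    · rw [if_neg]
      rintro ⟨k, hk⟩
      exact hn ⟨k, by simp only; omega⟩
    · rw [show Real.pi ^ 2 / 24 = 1 / 4 * (Real.pi ^ 2 / 6) by ring]
      convert! hasSum_zeta_two.mul_left (1 / 4 : ℝ) using 2 with k
      simp; ring
  have hone : HasSum (fun n : ℕ => if n = 1 then (1 : ℝ) else 0) 1 := hasSum_ite_eq 1 1
  convert! (hasSum_zeta_two.sub heven).sub hone using 2 with n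
  · rcases lt_or_ge n 3 with h | h
    · interval_cases n <;> simp
    · have h1 : n ≠ 1 := by omega
      have h3 : ¬ n < 3 := by omega
      by_cases h2 : Even n <;> simp [h1, h2, h3]
  · ring

/-- `0.8165` is an upper bound for `√(2/3)`: one factors `(2 / n) ^ (5/2)` as `(2 / n) ^ 2 * √(2 /
n)`. -/
theorem rpow_neg_le_of_three_le {σ : ℝ} (hσ : 5 / 2 ≤ σ) {n : ℕ} (hn : 3 ≤ n) :
    (n : ℝ) ^ (-σ) ≤ 2 ^ (-σ) * (0.8165 * 4 * (1 / (n : ℝ) ^ 2)) := by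
  have hn' : (3 : ℝ) ≤ n := by exact_mod_cast hn
  have hn0 : (0 : ℝ) < n := by linarith
  have h1 : (n : ℝ) ^ (-σ) = 2 ^ (-σ) * (2 / n : ℝ) ^ σ := by
    rw [Real.div_rpow two_pos.le hn0.le, Real.rpow_neg two_pos.le, Real.rpow_neg hn0.le]
    have := (Real.rpow_pos_of_pos two_pos σ).ne'
    field_simp
  have h2 : (2 / n : ℝ) ^ σ ≤ (2 / n : ℝ) ^ (2 : ℕ) * 0.8165 := by
    have hle : (2 / n : ℝ) ≤ 2 / 3 := by gcongr
    calc (2 / n : ℝ) ^ σ ≤ (2 / n : ℝ) ^ (5 / 2 : ℝ) :=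
          Real.rpow_le_rpow_of_exponent_ge (by positivity) (by linarith) hσ
      _ = (2 / n : ℝ) ^ (2 : ℕ) * Real.sqrt (2 / n) := by
          rw [Real.sqrt_eq_rpow, ← Real.rpow_natCast, ← Real.rpow_add (by positivity)]
          norm_num
      _ ≤ _ := by
          gcongr
          refine Real.sqrt_le_iff.2 ⟨by norm_num, hle.trans (by norm_num)⟩
  rw [h1]
  gcongr
  calc _ ≤ _ := h2
    _ = _ := by field_simp; ring

theorem oddMangoldt_div_log_sq_mul_rpow_le {σ : ℝ} (hσ : 5 / 2 ≤ σ) (n : ℕ) :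
    oddMangoldt n / Real.log n ^ 2 * (n : ℝ) ^ (-σ) ≤
      2 ^ (-σ) * (0.8165 * 4 / Real.log 3) *
        (if Even n ∨ n < 3 then (0 : ℝ) else 1 / (n : ℝ) ^ 2) := by
  split_ifs with h
  · have : oddMangoldt n = 0 := h.elim oddMangoldt_of_even oddMangoldt_eq_zero_of_lt
    simp [this]
  · push Not at h
    have hn' : (3 : ℝ) ≤ n := by exact_mod_cast h.2
    have h3 : 0 < Real.log 3 := Real.log_pos (by norm_num)
    have hlog : Real.log 3 ≤ Real.log n := Real.log_le_log (by norm_num) hn'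
    have hl0 : 0 < Real.log n := h3.trans_le hlog
    have h1 : oddMangoldt n / Real.log n ^ 2 ≤ 1 / Real.log 3 := by
      calc oddMangoldt n / Real.log n ^ 2 ≤ Real.log n / Real.log n ^ 2 := by
            gcongr; exact oddMangoldt_le_log n
        _ = 1 / Real.log n := by field_simp
        _ ≤ _ := by gcongr
    calc _ ≤ 1 / Real.log 3 * (2 ^ (-σ) * (0.8165 * 4 * (1 / (n : ℝ) ^ 2))) :=
          mul_le_mul h1 (rpow_neg_le_of_three_le hσ h.2) (by positivity) (by positivity)
      _ = _ := by ring

theorem oddMangoldt_div_log_sq_mul_rpow_nonneg (σ : ℝ) (n : ℕ) :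
    0 ≤ oddMangoldt n / Real.log n ^ 2 * (n : ℝ) ^ (-σ) :=
  mul_nonneg (div_nonneg (oddMangoldt_nonneg n) (sq_nonneg _)) (Real.rpow_nonneg n.cast_nonneg _)

theorem summable_oddMangoldt_div_log_sq {σ : ℝ} (hσ : 5 / 2 ≤ σ) :
    Summable fun n : ℕ => oddMangoldt n / Real.log n ^ 2 * (n : ℝ) ^ (-σ) :=
  Summable.of_nonneg_of_le (oddMangoldt_div_log_sq_mul_rpow_nonneg σ)
    (oddMangoldt_div_log_sq_mul_rpow_le hσ) (hasSum_odd_ge_three_inv_sq.summable.mul_left _)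

/-- This is the numerical input that needs `5/2 ≤ σ`. After `oddMangoldt n ≤ log n` and `log n ≥ log
3`, only the sum of `1 / n ^ 2` over odd `n ≥ 3` remains. -/
theorem tsum_oddMangoldt_div_log_sq_le {σ : ℝ} (hσ : 5 / 2 ≤ σ) :
    2 * Real.log 2 * ∑' n : ℕ, oddMangoldt n / Real.log n ^ 2 * (n : ℝ) ^ (-σ) ≤ 2 ^ (-σ) := by
  have h1 := (summable_oddMangoldt_div_log_sq hσ).tsum_le_tsum
    (oddMangoldt_div_log_sq_mul_rpow_le hσ) (hasSum_odd_ge_three_inv_sq.summable.mul_left _)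
  rw [tsum_mul_left, hasSum_odd_ge_three_inv_sq.tsum_eq] at h1
  have hl2 := Real.log_two_lt_d9
  have hl2' : 0 < Real.log 2 := Real.log_pos one_lt_two
  have hl3 := Real.log_three_gt_d9
  have hpi : Real.pi ^ 2 ≤ 3.1416 ^ 2 := pow_le_pow_left₀ Real.pi_pos.le Real.pi_lt_d4.le 2
  have hpi' : 3 ^ 2 ≤ Real.pi ^ 2 := pow_le_pow_left₀ (by norm_num) Real.pi_gt_three.le 2
  have hp : 0 < (2 : ℝ) ^ (-σ) := Real.rpow_pos_of_pos two_pos _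
  have hnum : 2 * Real.log 2 * (0.8165 * 4 / Real.log 3 * (Real.pi ^ 2 / 8 - 1)) ≤ 1 := by
    rw [div_mul_eq_mul_div, ← mul_div_assoc, div_le_one (by linarith)]
    calc 2 * Real.log 2 * (0.8165 * 4 * (Real.pi ^ 2 / 8 - 1))
        ≤ 2 * 0.6931471808 * (0.8165 * 4 * (3.1416 ^ 2 / 8 - 1)) := by gcongr; norm_num at hpi' ⊢; linarith
      _ ≤ Real.log 3 := by norm_num at *; linarith
  calc _ ≤ 2 * Real.log 2 * (2 ^ (-σ) * (0.8165 * 4 / Real.log 3) * (Real.pi ^ 2 / 8 - 1)) := by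
        gcongr
    _ = 2 ^ (-σ) * (2 * Real.log 2 * (0.8165 * 4 / Real.log 3 * (Real.pi ^ 2 / 8 - 1))) := by ring
    _ ≤ 2 ^ (-σ) * 1 := by gcongr
    _ = _ := mul_one _

/-- A quadratic trade-off between the argument of `oddZeta` and the real part of its logarithmic
derivative. -/
theorem sign_mul_re_oddLogDeriv_add_le {σ : ℝ} (hσ : 5 / 2 ≤ σ) (t : ℝ) {ε : ℝ} (hε : |ε| = 1) :
    ε * (oddLogDeriv (σ + t * Complex.I)).re +
      (oddLog (σ + t * Complex.I)).im ^ 2 * Real.log 2 / 2 ^ (-σ) ≤ oddLogDerivReal σ := by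
  have hσ1 : 1 < σ := by linarith
  set α := (oddLog (σ + t * Complex.I)).im with hα
  set P := (oddLogDeriv (σ + t * Complex.I)).re with hP
  set r : ℝ := 2 ^ (-σ) with hr
  have hr0 : 0 < r := Real.rpow_pos_of_pos two_pos _
  have hl2 : 0 < Real.log 2 := Real.log_pos one_lt_two
  set K := ∑' n : ℕ, oddMangoldt n / Real.log n ^ 2 * (n : ℝ) ^ (-σ) with hK
  have hKr : 2 * Real.log 2 * K ≤ r := tsum_oddMangoldt_div_log_sq_le hσ
  -- A Lagrange multiplier for a weighted Cauchy–Schwarz inequality. The optimum is `-α / K`; here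
  -- `K` is replaced by its upper bound `r / (2 * log 2)`.
  set l : ℝ := -(2 * α * Real.log 2 / r) with hl
  have hsum := ((((summable_oddMangoldt_mul_rpow hσ1).hasSum.sub
    ((hasSum_re_oddLogDeriv hσ1 t).mul_left ε)).add ((hasSum_im_oddLog hσ1 t).mul_left l)).add
    ((summable_oddMangoldt_div_log_sq hσ).hasSum.mul_left (l ^ 2 / 2)))
  have hnn : 0 ≤ oddLogDerivReal σ - ε * P + l * α + l ^ 2 / 2 * K := by
    refine hsum.nonneg fun n => ?_
    rcases lt_or_ge n 3 with hn | hn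
    · simp [oddMangoldt_eq_zero_of_lt hn]
    have hlog : 0 < Real.log n := Real.log_pos (by exact_mod_cast (by omega : 1 < n))
    have hw := oddMangoldt_mul_rpow_nonneg σ n
    set φ := t * Real.log n
    have hid : oddMangoldt n * (n : ℝ) ^ (-σ) -
        ε * (oddMangoldt n * (n : ℝ) ^ (-σ) * Real.cos φ) +
        l * -(oddMangoldt n / Real.log n * (n : ℝ) ^ (-σ) * Real.sin φ) +
        l ^ 2 / 2 * (oddMangoldt n / Real.log n ^ 2 * (n : ℝ) ^ (-σ)) =
        (oddMangoldt n * (n : ℝ) ^ (-σ)) * ((1 - ε * Real.cos φ - Real.sin φ ^ 2 / 2) +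
          (Real.sin φ - l / Real.log n) ^ 2 / 2) := by
      field_simp; ring
    change 0 ≤ oddMangoldt n * (n : ℝ) ^ (-σ) -
        ε * (oddMangoldt n * (n : ℝ) ^ (-σ) * Real.cos φ) +
        l * -(oddMangoldt n / Real.log n * (n : ℝ) ^ (-σ) * Real.sin φ) +
        l ^ 2 / 2 * (oddMangoldt n / Real.log n ^ 2 * (n : ℝ) ^ (-σ))
    rw [hid]
    refine mul_nonneg hw (add_nonneg ?_ (by positivity))
    have hsq : ε ^ 2 = 1 := by rw [← sq_abs, hε, one_pow]
    have : 1 - ε * Real.cos φ - Real.sin φ ^ 2 / 2 = (1 - ε * Real.cos φ) ^ 2 / 2 := by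
      rw [Real.sin_sq]; linear_combination (-Real.cos φ ^ 2 / 2) * hsq
    rw [this]; positivity
  have h1 : l ^ 2 / 2 * K ≤ α ^ 2 * Real.log 2 / r := by
    have : l ^ 2 / 2 * K = α ^ 2 * Real.log 2 / r ^ 2 * (2 * Real.log 2 * K) := by
      rw [hl]; field_simp
    rw [this]
    calc _ ≤ α ^ 2 * Real.log 2 / r ^ 2 * r := by gcongr
      _ = _ := by field_simp
  have h2 : l * α = -(2 * (α ^ 2 * Real.log 2 / r)) := by rw [hl]; ring
  linarith

theorem abs_re_oddLogDeriv_add_le {σ : ℝ} (hσ : 5 / 2 ≤ σ) (t : ℝ) :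
    |(oddLogDeriv (σ + t * Complex.I)).re| +
      (oddLog (σ + t * Complex.I)).im ^ 2 * Real.log 2 / 2 ^ (-σ) ≤ oddLogDerivReal σ := by
  have h1 := sign_mul_re_oddLogDeriv_add_le hσ t (ε := 1) (by simp)
  have h2 := sign_mul_re_oddLogDeriv_add_le hσ t (ε := -1) (by simp)
  rcases abs_cases (oddLogDeriv (σ + t * Complex.I)).re with h | h <;> linarith

/-- Two vanishing sines would give an integer relation between `log 3` and `log 5`. -/
theorem sin_log_three_ne_zero_or {t : ℝ} (ht : t ≠ 0) :
    Real.sin (t * Real.log 3) ≠ 0 ∨ Real.sin (t * Real.log 5) ≠ 0 := by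
  by_contra! h
  obtain ⟨k, hk⟩ := Real.sin_eq_zero_iff.1 h.1
  obtain ⟨m, hm⟩ := Real.sin_eq_zero_iff.1 h.2
  have h3 : 0 < Real.log 3 := Real.log_pos (by norm_num)
  have hrel : (m : ℝ) * Real.log 3 - k * Real.log 5 = 0 := by
    have : t * (m * Real.log 3 - k * Real.log 5) = 0 := by
      linear_combination m * (-hk) + k * hm
    exact (mul_eq_zero.1 this).resolve_left ht
  let S : Finset ℕ := {3, 5}
  have hS : ∀ p ∈ S, p.Prime := by intro p hp; simp [S] at hp; rcases hp with rfl | rfl <;> norm_num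
  have hm0 := sum_int_mul_log_prime_eq_zero S hS (fun p => if (p : ℕ) = 3 then m else -k) (by
    rw [Finset.sum_coe_sort S (fun p : ℕ => ((if p = 3 then m else -k : ℤ) : ℝ) * Real.log p)]
    simp only [S]
    rw [Finset.sum_pair (by norm_num)]
    push_cast
    norm_num
    linarith)
  have hk0 : k = 0 := by simpa using congrFun hm0 ⟨5, by simp [S]⟩
  rw [hk0] at hk
  have : t * Real.log 3 = 0 := by rw [← hk]; simp
  exact (mul_ne_zero ht h3.ne') this

/-- Equality in the triangle inequality would need `cos (t log p)` equal to one common sign at all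
odd primes; already 3 and 5 prevent this. -/
theorem abs_re_oddLogDeriv_lt {σ t : ℝ} (hσ : 1 < σ) (ht : t ≠ 0) :
    |(oddLogDeriv (σ + t * Complex.I)).re| < oddLogDerivReal σ := by
  have key (ε : ℝ) (hε : |ε| = 1) :
      0 < oddLogDerivReal σ - ε * (oddLogDeriv (σ + t * Complex.I)).re := by
    have hsum := (summable_oddMangoldt_mul_rpow hσ).hasSum.sub
      ((hasSum_re_oddLogDeriv hσ t).mul_left ε)
    have hfac (n : ℕ) : oddMangoldt n * (n : ℝ) ^ (-σ) -
        ε * (oddMangoldt n * (n : ℝ) ^ (-σ) * Real.cos (t * Real.log n)) =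
        oddMangoldt n * (n : ℝ) ^ (-σ) * (1 - ε * Real.cos (t * Real.log n)) := by ring
    have hle (n : ℕ) : ε * Real.cos (t * Real.log n) ≤ 1 := by
      refine (le_abs_self _).trans ?_
      rw [abs_mul, hε, one_mul]; exact Real.abs_cos_le_one _
    have hpos (p : ℕ) (hp : p.Prime) (h2 : p ≠ 2) (hs : Real.sin (t * Real.log p) ≠ 0) :
        0 < oddLogDerivReal σ - ε * (oddLogDeriv (σ + t * Complex.I)).re := by
      rw [oddLogDerivReal, ← hsum.tsum_eq]
      refine hsum.summable.tsum_pos (fun n => ?_) p ?_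
      · rw [hfac]
        exact mul_nonneg (oddMangoldt_mul_rpow_nonneg σ n) (by linarith [hle n])
      · rw [hfac, oddMangoldt_prime hp h2]
        have hp1 : (1 : ℝ) < p := by exact_mod_cast hp.one_lt
        have hlt : ε * Real.cos (t * Real.log p) < 1 := by
          refine lt_of_le_of_ne (hle p) fun h => hs ?_
          have h1 : (ε * Real.cos (t * Real.log p)) ^ 2 = 1 := by rw [h, one_pow]
          rw [mul_pow, ← sq_abs ε, hε, one_pow, one_mul, Real.cos_sq'] at h1
          exact pow_eq_zero_iff two_ne_zero |>.1 (by linarith)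
        exact mul_pos (mul_pos (Real.log_pos hp1) (Real.rpow_pos_of_pos (by linarith) _))
          (by linarith)
    rcases sin_log_three_ne_zero_or ht with h | h
    · exact hpos 3 (by norm_num) (by norm_num) (by exact_mod_cast h)
    · exact hpos 5 (by norm_num) (by norm_num) (by exact_mod_cast h)
  have h1 := key 1 (by simp)
  have h2 := key (-1) (by simp)
  rcases abs_cases (oddLogDeriv (σ + t * Complex.I)).re with h | h <;> linarith

/-- The function obtained from `ζ` by twisting its Euler factor at `2` by `c`. -/
noncomputable def zetaTwist (c s : ℂ) : ℂ := oddZeta s / (1 - c * 2 ^ (-s))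

theorem norm_two_cpow_neg (s : ℂ) : ‖(2 : ℂ) ^ (-s)‖ = 2 ^ (-s.re) := by
  have := Complex.norm_cpow_eq_rpow_re_of_pos two_pos (-s)
  simpa using this

theorem two_rpow_neg_lt_half {σ : ℝ} (hσ : 1 < σ) : (2 : ℝ) ^ (-σ) < 1 / 2 := by
  calc (2 : ℝ) ^ (-σ) < 2 ^ (-1 : ℝ) := Real.rpow_lt_rpow_of_exponent_lt one_lt_two (by linarith)
    _ = 1 / 2 := by rw [Real.rpow_neg_one]; norm_num

theorem one_sub_mul_two_cpow_ne_zero {c s : ℂ} (hc : ‖c‖ = 1) (hs : 1 < s.re) :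
    1 - c * 2 ^ (-s) ≠ 0 := by
  intro h
  have h1 : ‖c * 2 ^ (-s)‖ = 1 := by rw [← sub_eq_zero.1 h, norm_one]
  rw [norm_mul, hc, one_mul, norm_two_cpow_neg] at h1
  linarith [two_rpow_neg_lt_half hs]

theorem zetaTwist_one {s : ℂ} (hs : 1 < s.re) : zetaTwist 1 s = riemannZeta s := by
  have := one_sub_mul_two_cpow_ne_zero (c := 1) (by simp) hs
  rw [one_mul] at this
  rw [zetaTwist, oddZeta, one_mul, mul_div_cancel_left₀ _ this]

theorem zetaTwist_ne_zero {c s : ℂ} (hc : ‖c‖ = 1) (hs : 1 < s.re) : zetaTwist c s ≠ 0 :=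
  div_ne_zero (oddZeta_ne_zero hs) (one_sub_mul_two_cpow_ne_zero hc hs)

theorem hasDerivAt_zetaTwist {c s : ℂ} (hc : ‖c‖ = 1) (hs : 1 < s.re) :
    HasDerivAt (zetaTwist c)
      (-(oddLogDeriv s + Real.log 2 * (c * 2 ^ (-s) / (1 - c * 2 ^ (-s)))) * zetaTwist c s) s := by
  have hne := one_sub_mul_two_cpow_ne_zero hc hs
  have h2 : HasDerivAt (fun z : ℂ => 1 - c * (2 : ℂ) ^ (-z))
      (-(c * ((2 : ℂ) ^ (-s) * Complex.log 2 * -1))) s :=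
    (((hasDerivAt_neg' s).const_cpow (Or.inl two_ne_zero)).const_mul c).const_sub 1
  have h3 := (hasDerivAt_oddZeta hs).div h2 hne
  have hlog : ((Real.log 2 : ℝ) : ℂ) = Complex.log 2 := by
    rw [Complex.ofReal_log two_pos.le]; simp
  convert! h3 using 1
  rw [zetaTwist, hlog]
  field_simp
  ring

/-- The quotient is real exactly when `exp w` and `1 - z` are parallel, so their arguments have the
same squared sine. -/
theorem sin_sq_mul_normSq_of_im_div_eq_zero {w z : ℂ} (hz : 1 - z ≠ 0)
    (h : (Complex.exp w / (1 - z)).im = 0) :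
    Real.sin w.im ^ 2 * Complex.normSq (1 - z) = z.im ^ 2 := by
  have hN : Complex.normSq (1 - z) ≠ 0 := by simpa using hz
  have he := (Real.exp_pos w.re).ne'
  rw [Complex.div_im, Complex.exp_re, Complex.exp_im] at h
  simp only [Complex.sub_re, Complex.one_re, Complex.sub_im, Complex.one_im, zero_sub] at h
  rw [← sub_div, div_eq_zero_iff, or_iff_left hN] at h
  have h1 : Real.sin w.im * (1 - z.re) + Real.cos w.im * z.im = 0 := by
    have : Real.exp w.re * (Real.sin w.im * (1 - z.re) + Real.cos w.im * z.im) = 0 := by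
      linarith
    exact (mul_eq_zero.1 this).resolve_left he
  rw [Complex.normSq_apply]
  simp only [Complex.sub_re, Complex.one_re, Complex.sub_im, Complex.one_im, zero_sub]
  have h2 := Real.sin_sq_add_cos_sq w.im
  linear_combination (Real.sin w.im * (1 - z.re) - Real.cos w.im * z.im) * h1 + z.im ^ 2 * h2

theorem re_div_one_sub (z : ℂ) :
    (z / (1 - z)).re = (z.re - Complex.normSq z) / Complex.normSq (1 - z) := by
  rw [Complex.div_re, ← add_div, Complex.normSq_apply z]
  congr 1
  simp
  ring

/-- The optimization behind the key inequality. -/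
theorem lt_abs_re_div_one_sub {z : ℂ} {r p α : ℝ} (hr : 0 < r) (hzr : ‖z‖ = r)
    (hz : 1 - z ≠ 0) (hα : Real.sin α ^ 2 * Complex.normSq (1 - z) = z.im ^ 2)
    (h1 : p + α ^ 2 / r ≤ r / (1 + r)) (h2 : p < r / (1 + r)) :
    p < |(z / (1 - z)).re| := by
  have hr2 : Complex.normSq z = r ^ 2 := by rw [Complex.normSq_eq_norm_sq, hzr]
  rw [re_div_one_sub, hr2]
  have hN0 : 0 < Complex.normSq (1 - z) := Complex.normSq_pos.2 hz
  have hNv : Complex.normSq (1 - z) = 1 - 2 * z.re + r ^ 2 := by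
    rw [← hr2, Complex.normSq_apply, Complex.normSq_apply]; simp; ring
  rw [Complex.normSq_apply] at hr2
  set N := Complex.normSq (1 - z)
  set x := z.re
  set y := z.im
  set M := Real.sqrt N with hM
  have hM0 : 0 < M := Real.sqrt_pos.2 hN0
  have hM2 : M ^ 2 = N := Real.sq_sqrt hN0.le
  -- With `M = |1 - z|`, the target is `q / M`. Reality gives `q ^ 2 = r ^ 2 - sin² α`, and `M ^ 2 =
  -- (1 - x) - (x - r ^ 2) ≤ M + q * M` gives `M ≤ 1 + q`.
  set q := |x - r ^ 2| / M with hq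
  have hq0 : 0 ≤ q := by positivity
  have hqM : q * M = |x - r ^ 2| := by rw [hq]; field_simp
  have hq2 : q ^ 2 = r ^ 2 - Real.sin α ^ 2 := by
    have : q ^ 2 * N = (r ^ 2 - Real.sin α ^ 2) * N := by
      have h3 : q ^ 2 * N = (x - r ^ 2) ^ 2 := by rw [← hM2, ← mul_pow, hqM, sq_abs]
      rw [h3, sub_mul, hα, hNv]; linear_combination hr2
    exact mul_right_cancel₀ hN0.ne' this
  have hqr : q ≤ r := abs_le_of_sq_le_sq' (by rw [hq2]; linarith [sq_nonneg (Real.sin α)]) hr.le |>.2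
  have hMq : M ≤ 1 + q := by
    have hx : 1 - x ≤ M := by
      refine Real.le_sqrt_of_sq_le ?_
      have : N - (1 - x) ^ 2 = y ^ 2 := by rw [hNv]; linear_combination -hr2
      nlinarith [sq_nonneg y]
    have h4 : M ^ 2 ≤ (1 + q) * M := by
      rw [hM2, hNv, add_mul, hqM]
      have := neg_abs_le (x - r ^ 2)
      linarith
    rw [pow_two] at h4
    exact le_of_mul_le_mul_right h4 hM0
  have habs : |(x - r ^ 2) / N| = q / M := by
    rw [abs_div, abs_of_pos hN0, ← hM2, hq, div_div, ← pow_two]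
  rw [habs]
  have h5 : q / (1 + q) ≤ q / M := by gcongr
  refine lt_of_lt_of_le ?_ h5
  rcases hqr.eq_or_lt with h | h
  · rwa [h]
  · have hsα : r ^ 2 - q ^ 2 ≤ α ^ 2 := by
      have := Real.sin_sq_le_sq (x := α)
      linarith
    have h6 : (r ^ 2 - q ^ 2) / r ≤ α ^ 2 / r := by gcongr
    -- The loss from replacing `r` by `q` is less than the cost `α ^ 2 / r`. When `q = r` there is
    -- no loss, and the strict hypothesis `h2` is what decides.
    have h7 : r / (1 + r) - q / (1 + q) < (r ^ 2 - q ^ 2) / r := by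
      rw [div_sub_div _ _ (by positivity) (by positivity), div_lt_div_iff₀ (by positivity) hr]
      have hd : 0 < r - q := by linarith
      have : (r * (1 + q) - (1 + r) * q) * r = (r - q) * r := by ring
      rw [this, show (r ^ 2 - q ^ 2) * ((1 + r) * (1 + q)) = (r - q) * ((r + q) * ((1 + r) * (1 + q)))
        by ring]
      refine mul_lt_mul_of_pos_left ?_ hd
      nlinarith [mul_nonneg hr.le hq0, mul_pos hr hr, mul_nonneg (mul_nonneg hr.le hq0) hq0]
    linarith

/-- At a point where `zetaTwist c` is real, the Euler factor at `2` dominates the real part of the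
logarithmic derivative. -/
theorem abs_re_oddLogDeriv_lt_of_im_eq_zero {σ t : ℝ} (hσ : 5 / 2 ≤ σ) (ht : t ≠ 0)
    (hd : oddLogDerivReal σ ≤ Real.log 2 * (2 ^ (-σ) / (1 + 2 ^ (-σ)))) {c : ℂ} (hc : ‖c‖ = 1)
    (him : (zetaTwist c (σ + t * Complex.I)).im = 0) :
    |(oddLogDeriv (σ + t * Complex.I)).re| < Real.log 2 *
      |(c * 2 ^ (-(σ + t * Complex.I)) / (1 - c * 2 ^ (-(σ + t * Complex.I)))).re| := by
  have hσ1 : 1 < σ := by linarith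
  have hs : 1 < (σ + t * Complex.I : ℂ).re := by simpa using hσ1
  have hl2 : 0 < Real.log 2 := Real.log_pos one_lt_two
  rw [← div_lt_iff₀' hl2]
  refine lt_abs_re_div_one_sub (r := 2 ^ (-σ)) (α := (oddLog (σ + t * Complex.I)).im)
    (Real.rpow_pos_of_pos two_pos _) ?_ (one_sub_mul_two_cpow_ne_zero hc hs) ?_ ?_ ?_
  · rw [norm_mul, hc, one_mul, norm_two_cpow_neg]; simp
  · refine sin_sq_mul_normSq_of_im_div_eq_zero (one_sub_mul_two_cpow_ne_zero hc hs) ?_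
    rw [exp_oddLog hs]; exact him
  · have := (abs_re_oddLogDeriv_add_le hσ t).trans hd
    rw [← div_le_iff₀' hl2] at this
    refine le_trans (le_of_eq ?_) this
    field_simp
  · rw [div_lt_iff₀' hl2]
    exact (abs_re_oddLogDeriv_lt hσ1 ht).trans_le hd

end KeyInequality

/-! ### The equation for E: monotonicity, existence and the bound E > 5/2 -/

section TitchmarshConstant

theorem oddLogDerivReal_pos {σ : ℝ} (hσ : 1 < σ) : 0 < oddLogDerivReal σ :=
  (summable_oddMangoldt_mul_rpow hσ).tsum_pos (oddMangoldt_mul_rpow_nonneg σ) 3 (by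
    rw [oddMangoldt_prime Nat.prime_three (by norm_num)]
    exact mul_pos (Real.log_pos (by norm_num)) (Real.rpow_pos_of_pos (by norm_num) _))

/-- The series has no terms below `n = 3`, so each term decays at least as fast as `3 ^ (-σ)`. This
beats the growth of `1 + 2 ^ σ`. -/
theorem oddLogDerivReal_le {σ σ' : ℝ} (hσ : 1 < σ) (h : σ ≤ σ') :
    oddLogDerivReal σ' ≤ 3 ^ (-(σ' - σ)) * oddLogDerivReal σ := by
  rw [oddLogDerivReal, oddLogDerivReal, ← tsum_mul_left]
  refine (summable_oddMangoldt_mul_rpow (hσ.trans_le h)).tsum_le_tsum (fun n => ?_)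
    ((summable_oddMangoldt_mul_rpow hσ).mul_left _)
  rcases lt_or_ge n 3 with hn | hn
  · simp [oddMangoldt_eq_zero_of_lt hn]
  have hn' : (3 : ℝ) ≤ n := by exact_mod_cast hn
  have h1 : (n : ℝ) ^ (-σ') = (n : ℝ) ^ (-(σ' - σ)) * (n : ℝ) ^ (-σ) := by
    rw [← Real.rpow_add (by linarith)]; congr 1; ring
  have h2 : (n : ℝ) ^ (-(σ' - σ)) ≤ 3 ^ (-(σ' - σ)) :=
    Real.rpow_le_rpow_of_nonpos (by norm_num) hn' (by linarith)
  have hw := oddMangoldt_mul_rpow_nonneg σ n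
  rw [h1]
  calc _ = (n : ℝ) ^ (-(σ' - σ)) * (oddMangoldt n * (n : ℝ) ^ (-σ)) := by ring
    _ ≤ _ := by gcongr

/-- `(1 + 2 ^ σ) * oddLogDerivReal σ`, which equals `log 2` exactly at the Titchmarsh solution. -/
noncomputable def titchmarshFun (σ : ℝ) : ℝ := (1 + 2 ^ σ) * oddLogDerivReal σ

theorem titchmarshFun_pos {σ : ℝ} (hσ : 1 < σ) : 0 < titchmarshFun σ :=
  mul_pos (add_pos one_pos (Real.rpow_pos_of_pos two_pos _)) (oddLogDerivReal_pos hσ)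

theorem titchmarshFun_le {σ σ' : ℝ} (hσ : 1 < σ) (h : σ ≤ σ') :
    titchmarshFun σ' ≤ (2 / 3 : ℝ) ^ (σ' - σ) * titchmarshFun σ := by
  have h1 : (1 + 2 ^ σ' : ℝ) ≤ 2 ^ (σ' - σ) * (1 + 2 ^ σ) := by
    rw [mul_add, ← Real.rpow_add two_pos, sub_add_cancel, mul_one]
    gcongr
    exact Real.one_le_rpow one_le_two (by linarith)
  have h2 : (2 / 3 : ℝ) ^ (σ' - σ) = 2 ^ (σ' - σ) * 3 ^ (-(σ' - σ)) := by
    rw [Real.div_rpow two_pos.le (by norm_num), Real.rpow_neg (by norm_num), div_eq_mul_inv]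
  rw [titchmarshFun, titchmarshFun, h2]
  calc _ ≤ (2 ^ (σ' - σ) * (1 + 2 ^ σ)) * (3 ^ (-(σ' - σ)) * oddLogDerivReal σ) :=
        mul_le_mul h1 (oddLogDerivReal_le hσ h) (oddLogDerivReal_nonneg _)
          (by have := Real.rpow_pos_of_pos two_pos (σ' - σ)
              have := Real.rpow_pos_of_pos two_pos σ
              positivity)
    _ = _ := by ring

theorem titchmarshFun_strictAntiOn : StrictAntiOn titchmarshFun (Set.Ioi 1) := by
  intro σ hσ σ' _ h
  calc titchmarshFun σ' ≤ (2 / 3 : ℝ) ^ (σ' - σ) * titchmarshFun σ := titchmarshFun_le hσ h.le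
    _ < 1 * titchmarshFun σ := by
        gcongr
        · exact titchmarshFun_pos hσ
        · exact Real.rpow_lt_one (by norm_num) (by norm_num) (by linarith)
    _ = _ := one_mul _

theorem differentiableAt_oddLogDeriv {s : ℂ} (hs : 1 < s.re) : DifferentiableAt ℂ oddLogDeriv s :=
  (LSeries_hasDerivAt (abscissa_oddMangoldt_le.trans_lt (by exact_mod_cast hs))).differentiableAt

theorem continuousOn_titchmarshFun : ContinuousOn titchmarshFun (Set.Ioi 1) := by
  have h1 : ContinuousOn oddLogDerivReal (Set.Ioi 1) := by
    intro σ hσ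
    have hc : ContinuousAt (fun σ : ℝ => (oddLogDeriv (σ : ℂ)).re) σ :=
      Complex.continuous_re.continuousAt.comp
        ((differentiableAt_oddLogDeriv (s := (σ : ℂ)) (by simpa using hσ)).continuousAt.comp
          Complex.continuous_ofReal.continuousAt)
    refine (hc.congr ?_).continuousWithinAt
    filter_upwards [Ioi_mem_nhds hσ] with x hx
    rw [oddLogDeriv_ofReal hx, Complex.ofReal_re]
  refine ContinuousOn.mul ?_ h1
  exact (continuous_const.add (Real.continuous_const_rpow two_ne_zero)).continuousOn

theorem natCast_rpow_neg_five_half (n : ℕ) :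
    (n : ℝ) ^ (-(5 / 2) : ℝ) = 1 / ((n : ℝ) ^ 2 * Real.sqrt n) := by
  rcases Nat.eq_zero_or_pos n with rfl | hn
  · simp
  have hn' : (0 : ℝ) < n := by exact_mod_cast hn
  rw [Real.rpow_neg hn'.le, one_div, Real.sqrt_eq_rpow, ← Real.rpow_natCast, ← Real.rpow_add hn']
  norm_num

/-- The terms at 3, 5 and 7 already suffice, even with `log 7` bounded below by `log 5`. It places
`E` in the range of the key inequality. -/
theorem log_two_lt_titchmarshFun : Real.log 2 < titchmarshFun (5 / 2) := by
  have hsum : ∑ n ∈ ({3, 5, 7} : Finset ℕ), oddMangoldt n * (n : ℝ) ^ (-(5 / 2) : ℝ) ≤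
      oddLogDerivReal (5 / 2) :=
    (summable_oddMangoldt_mul_rpow (by norm_num)).sum_le_tsum _
      fun n _ => oddMangoldt_mul_rpow_nonneg _ n
  have hterm (p : ℕ) (hp : p.Prime) (h2 : p ≠ 2) (l m : ℝ) (hl0 : 0 < l) (hm0 : 0 < m)
      (hl : l ≤ Real.log p) (hm : (p : ℝ) ≤ m ^ 2) :
      l * (1 / ((p : ℝ) ^ 2 * m)) ≤ oddMangoldt p * (p : ℝ) ^ (-(5 / 2) : ℝ) := by
    rw [oddMangoldt_prime hp h2, natCast_rpow_neg_five_half]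
    have hp0 : (0 : ℝ) < p := by exact_mod_cast hp.pos
    have : 0 < Real.sqrt p := Real.sqrt_pos.2 hp0
    have : Real.sqrt p ≤ m := Real.sqrt_le_iff.2 ⟨hm0.le, hm⟩
    gcongr
  have hlog7 : (1.6094 : ℝ) ≤ Real.log (7 : ℕ) := by
    have h : (1.6094 : ℝ) ≤ Real.log 5 := by have := Real.log_five_gt_d9; linarith
    exact h.trans (Real.log_le_log (by norm_num) (by norm_num))
  have h3 := hterm 3 (by norm_num) (by norm_num) 1.0986 1.7321 (by norm_num) (by norm_num)
    (by have := Real.log_three_gt_d9; push_cast; linarith) (by norm_num)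
  have h5 := hterm 5 (by norm_num) (by norm_num) 1.6094 2.2361 (by norm_num) (by norm_num)
    (by have := Real.log_five_gt_d9; push_cast; linarith) (by norm_num)
  have h7 := hterm 7 (by norm_num) (by norm_num) 1.6094 2.6458 (by norm_num) (by norm_num)
    hlog7 (by norm_num)
  rw [Finset.sum_insert (by norm_num), Finset.sum_insert (by norm_num), Finset.sum_singleton]
    at hsum
  have hd : (0.111 : ℝ) ≤ oddLogDerivReal (5 / 2) := by
    norm_num at h3 h5 h7 hsum ⊢
    linarith
  have h2 : (5.65 : ℝ) ≤ 2 ^ (5 / 2 : ℝ) := by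
    have h := natCast_rpow_neg_five_half 2
    rw [Real.rpow_neg (by norm_num), one_div, inv_inj] at h
    push_cast at h
    rw [h]
    have : (1.4141 : ℝ) ≤ Real.sqrt 2 := Real.le_sqrt_of_sq_le (by norm_num)
    linarith
  have := Real.log_two_lt_d9
  rw [titchmarshFun]
  nlinarith

theorem two_rpow_neg_div_eq (σ : ℝ) : (2 : ℝ) ^ (-σ) / (1 + 2 ^ (-σ)) = 1 / (1 + 2 ^ σ) := by
  have := Real.rpow_pos_of_pos two_pos σ
  rw [Real.rpow_neg two_pos.le]
  field_simp
  ring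

theorem hasDerivAt_riemannZeta {s : ℂ} (hs : 1 < s.re) :
    HasDerivAt riemannZeta
      (-(oddLogDeriv s + Real.log 2 * (1 * 2 ^ (-s) / (1 - 1 * 2 ^ (-s)))) * riemannZeta s) s := by
  have h := hasDerivAt_zetaTwist (c := 1) (by simp) hs
  rw [zetaTwist_one hs] at h
  refine h.congr_of_eventuallyEq ?_
  filter_upwards [isOpen_one_lt_re.mem_nhds hs] with z hz using (zetaTwist_one hz).symm

theorem eulerTerm_ofReal (c σ : ℝ) :
    (c * 2 ^ (-(σ : ℂ)) / (1 - c * 2 ^ (-(σ : ℂ))) : ℂ) =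
      ((c * 2 ^ (-σ) / (1 - c * 2 ^ (-σ)) : ℝ) : ℂ) := by
  push_cast
  rw [Complex.ofReal_cpow two_pos.le]
  push_cast
  ring

/-- With `x = 2 ^ σ`, `2 * x / (x ^ 2 - 1) = 1 / (x - 1) + 1 / (x + 1)`, and the first fraction
cancels against the Euler factor at 2 in `-ζ'/ζ`. -/
theorem isTitchmarshSolution_iff (σ : ℝ) :
    IsTitchmarshSolution σ ↔ 1 < σ ∧ titchmarshFun σ = Real.log 2 := by
  refine and_congr_right fun hσ => ?_
  have hs : 1 < (σ : ℂ).re := by simpa using hσ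
  rw [(hasDerivAt_riemannZeta hs).deriv, mul_div_assoc, div_self (riemannZeta_ne_zero_of_one_lt_re hs),
    mul_one, neg_neg, oddLogDeriv_ofReal hσ]
  have hcast := eulerTerm_ofReal 1 σ
  rw [Complex.ofReal_one, one_mul, one_mul] at hcast
  rw [one_mul, hcast]
  norm_cast
  have hx : 1 < (2 : ℝ) ^ σ := Real.one_lt_rpow one_lt_two (by linarith)
  have h4 : (4 : ℝ) ^ σ = (2 ^ σ) ^ 2 := by
    rw [← Real.rpow_natCast, ← Real.rpow_mul two_pos.le, mul_comm, Real.rpow_mul two_pos.le]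
    norm_num
  rw [titchmarshFun, h4, Real.rpow_add two_pos, Real.rpow_one, Real.rpow_neg two_pos.le]
  set x := (2 : ℝ) ^ σ
  have h1 : x - 1 ≠ 0 := by linarith
  have h2 : 1 + x ≠ 0 := by linarith
  have h3 : x ≠ 0 := by linarith
  have h5 : x⁻¹ / (1 - x⁻¹) = 1 / (x - 1) := by field_simp
  have h6 : x * 2 / (x ^ 2 - 1) = 1 / (x - 1) + 1 / (1 + x) := by
    rw [show x ^ 2 - 1 = (x - 1) * (1 + x) by ring]
    field_simp; ring
  rw [h5, h6]
  constructor
  · intro h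
    have : oddLogDerivReal σ = Real.log 2 / (1 + x) := by linear_combination -h
    rw [this]; field_simp
  · intro h
    rw [← h]; field_simp; ring

theorem exists_titchmarsh_constant : ∃ E : ℝ, 5 / 2 < E ∧ titchmarshFun E = Real.log 2 := by
  have hlim : Tendsto (fun σ : ℝ => (2 / 3 : ℝ) ^ (σ - 5 / 2) * titchmarshFun (5 / 2)) atTop (𝓝 0) := by
    have h1 : Tendsto (fun σ : ℝ => (2 / 3 : ℝ) ^ (σ - 5 / 2)) atTop (𝓝 0) :=
      (tendsto_rpow_atTop_of_base_lt_one _ (by norm_num) (by norm_num)).comp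
        (tendsto_atTop_add_const_right _ _ tendsto_id)
    simpa using h1.mul_const (titchmarshFun (5 / 2))
  obtain ⟨M, hM, hMge⟩ := ((hlim.eventually (gt_mem_nhds (Real.log_pos one_lt_two))).and
    (eventually_ge_atTop (5 / 2))).exists
  have hMlt : titchmarshFun M < Real.log 2 := (titchmarshFun_le (by norm_num) hMge).trans_lt hM
  obtain ⟨E, hE, hEq⟩ := intermediate_value_Icc' hMge
    (continuousOn_titchmarshFun.mono fun x hx => lt_of_lt_of_le (by norm_num) hx.1)
    ⟨hMlt.le, log_two_lt_titchmarshFun.le⟩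
  refine ⟨E, lt_of_le_of_ne hE.1 fun h => ?_, hEq⟩
  rw [← h] at hEq
  exact log_two_lt_titchmarshFun.ne' hEq

theorem oddLogDerivReal_le_iff (σ : ℝ) :
    oddLogDerivReal σ ≤ Real.log 2 * (2 ^ (-σ) / (1 + 2 ^ (-σ))) ↔
      titchmarshFun σ ≤ Real.log 2 := by
  have := Real.rpow_pos_of_pos two_pos σ
  rw [two_rpow_neg_div_eq, mul_one_div, le_div_iff₀' (by positivity), titchmarshFun]

end TitchmarshConstant

/-! ### Disappearing zeros of the imaginary part force a vertical tangent -/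

section Fold

theorem eventually_pos_and_neg_of_deriv_neg {ψ : ℝ → ℝ} {c d : ℝ} (h : HasDerivAt ψ d c)
    (h0 : ψ c = 0) (hd : d < 0) : ∀ᶠ η in 𝓝[>] (0 : ℝ), 0 < ψ (c - η) ∧ ψ (c + η) < 0 := by
  have hs : ∀ᶠ x in 𝓝[≠] c, slope ψ c x < 0 :=
    (hasDerivAt_iff_tendsto_slope.1 h).eventually (gt_mem_nhds hd)
  rw [eventually_nhdsWithin_iff, Metric.eventually_nhds_iff] at hs
  obtain ⟨κ, hκ, hs⟩ := hs
  filter_upwards [Ioo_mem_nhdsGT hκ] with η hη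
  have h1 := hs (y := c - η) (by simp [abs_of_pos hη.1, hη.2]) (by simp [hη.1.ne'])
  have h2 := hs (y := c + η) (by simp [abs_of_pos hη.1, hη.2]) (by simp [hη.1.ne'])
  rw [slope_def_field, h0, sub_zero] at h1 h2
  rw [div_neg_iff] at h1 h2
  constructor
  · rcases h1 with h1 | h1
    · exact h1.1
    · linarith [h1.2, hη.1]
  · rcases h2 with h2 | h2
    · linarith [h2.2, hη.1]
    · exact h2.1

/-- Take the first point where `ψ ≤ 0`: a positive derivative there would make `ψ` negative slightly
earlier. -/
theorem exists_zero_deriv_nonpos {ψ ψ' : ℝ → ℝ} {a b : ℝ} (hab : a ≤ b)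
    (hd : ∀ x ∈ Set.Icc a b, HasDerivAt ψ (ψ' x) x) (ha : 0 < ψ a) (hb : ψ b < 0) :
    ∃ c ∈ Set.Icc a b, ψ c = 0 ∧ ψ' c ≤ 0 := by
  have hcont : ContinuousOn ψ (Set.Icc a b) := fun x hx => (hd x hx).continuousAt.continuousWithinAt
  have hcpt : IsCompact (Set.Icc a b ∩ ψ ⁻¹' Set.Iic 0) :=
    isCompact_Icc.of_isClosed_subset (hcont.preimage_isClosed_of_isClosed isClosed_Icc isClosed_Iic)
      Set.inter_subset_left
  obtain ⟨c, ⟨hc, hc0⟩, hmin⟩ := hcpt.exists_isLeast ⟨b, ⟨hab, le_rfl⟩, hb.le⟩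
  have hc0' : ψ c ≤ 0 := hc0
  have hzero : ψ c = 0 := by
    obtain ⟨x, hx, hx0⟩ := intermediate_value_Icc' hc.1
      (hcont.mono (Set.Icc_subset_Icc_right hc.2)) ⟨hc0', ha.le⟩
    have : c ≤ x := hmin ⟨⟨hx.1, hx.2.trans hc.2⟩, hx0.le⟩
    rw [le_antisymm this hx.2]; exact hx0
  have hac : a < c := lt_of_le_of_ne hc.1 (by rintro rfl; linarith)
  refine ⟨c, hc, hzero, ?_⟩
  by_contra! hpos
  have hev := eventually_pos_and_neg_of_deriv_neg (hd c hc).fun_neg (by simp [hzero])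
    (neg_neg_of_pos hpos)
  obtain ⟨η, hη, hη'⟩ := (hev.and (Ioo_mem_nhdsGT (sub_pos.2 hac))).exists
  have h1 : ψ (c - η) < 0 := by linarith [hη.1]
  have := hmin ⟨⟨by linarith [hη'.2], by linarith [hη'.1, hc.2]⟩, h1.le⟩
  linarith [hη'.1]

theorem hasDerivAt_im_vertical {f : ℂ → ℂ} {f' : ℂ} {σ τ : ℝ}
    (h : HasDerivAt f f' (σ + τ * Complex.I)) :
    HasDerivAt (fun y : ℝ => (f (σ + y * Complex.I)).im) f'.re τ := by
  have h1 : HasDerivAt (fun y : ℝ => (σ + y * Complex.I : ℂ)) Complex.I τ := by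
    simpa using ((Complex.ofRealCLM.hasDerivAt (x := τ)).mul_const Complex.I).const_add (σ : ℂ)
  have h2 := h.comp τ h1
  have h3 := Complex.imCLM.hasFDerivAt.comp_hasDerivAt τ h2
  have h4 : Complex.imCLM (f' * Complex.I) = f'.re := by simp
  rw [h4] at h3
  exact h3

/-- If the decreasing zeros of `τ ↦ Im f (σ + iτ)` present on the left side of a box disappear on
its right side, without leaving through the horizontal sides, then the box contains a point of the
curve `Im f = 0` with vertical tangent. -/
theorem exists_im_eq_zero_re_deriv_eq_zero {f f' : ℂ → ℂ} {a e p q : ℝ} (hae : a ≤ e)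
    (hf : ∀ s : ℂ, s.re ∈ Set.Icc a e → s.im ∈ Set.Icc p q → HasDerivAt f (f' s) s)
    (hf' : ContinuousOn f' (Set.Icc a e ×ℂ Set.Icc p q))
    (hp : ∀ σ ∈ Set.Icc a e, (f (σ + p * Complex.I)).im ≠ 0)
    (hq : ∀ σ ∈ Set.Icc a e, (f (σ + q * Complex.I)).im ≠ 0)
    (hright : ∀ τ ∈ Set.Icc p q, (f (e + τ * Complex.I)).im = 0 → 0 < (f' (e + τ * Complex.I)).re)
    (hleft : ∃ τ₀ ∈ Set.Icc p q, ∃ τ₁ ∈ Set.Icc p q, τ₀ ≤ τ₁ ∧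
      0 < (f (a + τ₀ * Complex.I)).im ∧ (f (a + τ₁ * Complex.I)).im < 0) :
    ∃ b : ℂ, a ≤ b.re ∧ (f b).im = 0 ∧ (f' b).re = 0 ∧ b.re ∈ Set.Icc a e ∧
      b.im ∈ Set.Icc p q := by
  have hcross (σ : ℝ) (hσ : σ ∈ Set.Icc a e) (τ₀ τ₁ : ℝ) (h0 : τ₀ ∈ Set.Icc p q)
      (h1 : τ₁ ∈ Set.Icc p q) (h01 : τ₀ ≤ τ₁) (hpos : 0 < (f (σ + τ₀ * Complex.I)).im)
      (hneg : (f (σ + τ₁ * Complex.I)).im < 0) :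
      ∃ τ ∈ Set.Icc p q, (f (σ + τ * Complex.I)).im = 0 ∧ (f' (σ + τ * Complex.I)).re ≤ 0 := by
    obtain ⟨τ, hτ, h⟩ := exists_zero_deriv_nonpos (ψ := fun y : ℝ => (f (σ + y * Complex.I)).im)
      (ψ' := fun y : ℝ => (f' (σ + y * Complex.I)).re) h01
      (fun x hx => hasDerivAt_im_vertical (hf _ (by simpa using hσ)
        (by simpa using ⟨h0.1.trans hx.1, hx.2.trans h1.2⟩))) hpos hneg
    exact ⟨τ, ⟨h0.1.trans hτ.1, hτ.2.trans h1.2⟩, h⟩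
  set K : Set ℂ := Set.Icc a e ×ℂ Set.Icc p q with hK
  have hKc : IsCompact K := isCompact_Icc.reProdIm isCompact_Icc
  have hfc : ContinuousOn f K := fun s hs => (hf s hs.1 hs.2).continuousAt.continuousWithinAt
  let g : ℂ → ℝ × ℝ := fun s => ((f s).im, (f' s).re)
  have hgc : ContinuousOn g K :=
    (Complex.continuous_im.comp_continuousOn hfc).prodMk (Complex.continuous_re.comp_continuousOn hf')
  have hZc : IsCompact (K ∩ g ⁻¹' (({0} : Set ℝ) ×ˢ Set.Iic 0)) :=
    hKc.of_isClosed_subset (hgc.preimage_isClosed_of_isClosed hKc.isClosed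
      (isClosed_singleton.prod isClosed_Iic)) Set.inter_subset_left
  obtain ⟨τ₀, h0, τ₁, h1, h01, hpos, hneg⟩ := hleft
  obtain ⟨τ, hτ, hz, hz'⟩ := hcross a ⟨le_rfl, hae⟩ τ₀ τ₁ h0 h1 h01 hpos hneg
  -- Choose a rightmost zero of `im f` with `re f' ≤ 0`. Were `re f'` negative at `b`, the strict
  -- sign change would persist on a line slightly further right and give another such zero there.
  obtain ⟨b, ⟨hbK, hb⟩, hmax⟩ := hZc.exists_isMaxOn (f := Complex.re)
    ⟨a + τ * Complex.I, ⟨by simp [hae], by simpa using hτ⟩, hz, hz'⟩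
    Complex.continuous_re.continuousOn
  have hbim : (f b).im = 0 := hb.1
  have hbre : (f' b).re ≤ 0 := hb.2
  refine ⟨b, hbK.1.1, hbim, le_antisymm hbre ?_, hbK.1, hbK.2⟩
  by_contra! hlt
  have hbeq : b = (b.re : ℂ) + (b.im : ℂ) * Complex.I := (Complex.re_add_im b).symm
  have hbe : b.re < e := by
    refine lt_of_le_of_ne hbK.1.2 fun h => ?_
    rw [h] at hbeq
    have := hright b.im hbK.2 (by rw [← hbeq]; exact hbim)
    rw [← hbeq] at this
    linarith
  have hbp : p < b.im := lt_of_le_of_ne hbK.2.1 fun h => hp b.re hbK.1 (by rw [h, ← hbeq, hbim])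
  have hbq : b.im < q := lt_of_le_of_ne hbK.2.2 fun h => hq b.re hbK.1 (by rw [← h, ← hbeq, hbim])
  have hder : HasDerivAt (fun y : ℝ => (f (b.re + y * Complex.I)).im) (f' b).re b.im :=
    hasDerivAt_im_vertical (by rw [← hbeq]; exact hf b hbK.1 hbK.2)
  obtain ⟨η, ⟨hη1, hη2⟩, hη3, hη4⟩ := ((eventually_pos_and_neg_of_deriv_neg hder
    (by rw [← hbeq]; exact hbim) hlt).and (Ioo_mem_nhdsGT (lt_min (sub_pos.2 hbp)
      (sub_pos.2 hbq)))).exists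
  have hη5 := hη4.trans_le (min_le_left _ _)
  have hη6 := hη4.trans_le (min_le_right _ _)
  have hm0 : b.im - η ∈ Set.Icc p q := ⟨by linarith, by linarith⟩
  have hm1 : b.im + η ∈ Set.Icc p q := ⟨by linarith, by linarith⟩
  have hcont (y : ℝ) (hy : y ∈ Set.Icc p q) :
      ContinuousAt (fun x : ℝ => (f (x + y * Complex.I)).im) b.re := by
    have h1 : ContinuousAt f (b.re + y * Complex.I) :=
      (hf _ (by simpa using hbK.1) (by simpa using hy)).continuousAt
    have h2 : ContinuousAt (fun x : ℝ => (x + y * Complex.I : ℂ)) b.re := by fun_prop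
    exact Complex.continuous_im.continuousAt.comp
      (ContinuousAt.comp (f := fun x : ℝ => (x + y * Complex.I : ℂ)) h1 h2)
  have hev : ∀ᶠ x : ℝ in 𝓝 b.re, 0 < (f (x + (b.im - η : ℝ) * Complex.I)).im ∧
      (f (x + (b.im + η : ℝ) * Complex.I)).im < 0 :=
    ((hcont _ hm0).tendsto.eventually_const_lt hη1).and
      ((hcont _ hm1).tendsto.eventually_lt_const hη2)
  obtain ⟨x, ⟨hx1, hx2⟩, hx3⟩ := ((hev.filter_mono nhdsWithin_le_nhds).and (Ioo_mem_nhdsGT hbe)).exists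
  have hxI : x ∈ Set.Icc a e := ⟨hbK.1.1.trans hx3.1.le, hx3.2.le⟩
  obtain ⟨y, hy, hy1, hy2⟩ := hcross x hxI _ _ hm0 hm1 (by linarith) hx1 hx2
  have := hmax (a := (x + y * Complex.I : ℂ)) ⟨⟨by simpa using hxI, by simpa using hy⟩, hy1, hy2⟩
  have h7 : x ≤ b.re := by simpa using this
  linarith [hx3.1]

end Fold

/-! ### Vertical translates of ζ approximating the sign-twisted Euler product -/

section Shifts

/-- The completely multiplicative function with value `-1` at `2` and `1` at odd primes. -/
noncomputable def twoSign (n : ℕ) : ℂ := (-1) ^ n.factorization 2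

theorem norm_twoSign (n : ℕ) : ‖twoSign n‖ = 1 := by simp [twoSign]

theorem twoSign_mul {m n : ℕ} (hm : m ≠ 0) (hn : n ≠ 0) :
    twoSign (m * n) = twoSign m * twoSign n := by
  rw [twoSign, Nat.factorization_mul hm hn, Finsupp.add_apply, pow_add]; rfl

theorem twoSign_prime {p : ℕ} (hp : p.Prime) : twoSign p = if p = 2 then -1 else 1 := by
  rw [twoSign, hp.factorization, Finsupp.single_apply]
  split_ifs <;> simp

theorem twoSign_odd {n : ℕ} (hn : ¬ Even n) : twoSign n = 1 := by
  rw [twoSign, Nat.factorization_eq_zero_of_not_dvd (by rwa [← even_iff_two_dvd]), pow_zero]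

/-- Kronecker's theorem handles the primes below `k` with error `1 / (k + 1)`; multiplicativity
extends the limit to all `n`. -/
theorem exists_shift_tendsto_twoSign : ∃ T : ℕ → ℝ, ∀ n : ℕ, n ≠ 0 →
    Tendsto (fun k => (n : ℂ) ^ (-(T k * Complex.I))) atTop (𝓝 (twoSign n)) := by
  have hex (k : ℕ) : ∃ t : ℝ, ∀ p : ℕ, p.Prime → p < k →
      ‖(p : ℂ) ^ (-(t * Complex.I)) - twoSign p‖ < 1 / ((k : ℝ) + 1) := by
    let S : Finset ℕ := (Finset.range k).filter Nat.Prime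
    have hS : ∀ p ∈ S, p.Prime := fun p hp => (Finset.mem_filter.1 hp).2
    obtain ⟨t, ht⟩ := kronecker_approximation (fun p : S => Real.log (p : ℕ))
      (sum_int_mul_log_prime_eq_zero S hS) (fun p => twoSign p) (fun p => norm_twoSign p)
      (ε := 1 / ((k : ℝ) + 1)) (by positivity)
    refine ⟨-t, fun p hp hpk => ?_⟩
    have := ht ⟨p, Finset.mem_filter.2 ⟨Finset.mem_range.2 hpk, hp⟩⟩
    have hp0 : (p : ℂ) ≠ 0 := by exact_mod_cast hp.ne_zero
    rw [Complex.cpow_def_of_ne_zero hp0, ← Complex.natCast_log]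
    convert! this using 4
    push_cast; ring
  choose T hT using hex
  refine ⟨T, fun n => ?_⟩
  induction n using induction_on_primes with
  | zero => simp
  | one => simp [twoSign]
  | prime_mul p a hp ih =>
    intro hpa
    have ha : a ≠ 0 := right_ne_zero_of_mul hpa
    rw [twoSign_mul hp.ne_zero ha]
    have h1 : Tendsto (fun k => (p : ℂ) ^ (-(T k * Complex.I))) atTop (𝓝 (twoSign p)) := by
      rw [tendsto_iff_norm_sub_tendsto_zero]
      refine squeeze_zero' (Eventually.of_forall fun k => norm_nonneg _) ?_
        tendsto_one_div_add_atTop_nhds_zero_nat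
      filter_upwards [eventually_gt_atTop p] with k hk using (hT k p hp hk).le
    refine (h1.mul (ih ha)).congr fun k => ?_
    rw [Nat.cast_mul, Complex.natCast_mul_natCast_cpow]

open LSeries

theorem LSeriesSummable_twoSign {s : ℂ} (hs : 1 < s.re) : LSeriesSummable twoSign s :=
  LSeriesSummable_of_bounded_of_one_lt_re (m := 1) (fun n _ => (norm_twoSign n).le) hs

/-- Since `twoSign (2 * m) = -twoSign m`, multiplying the series by `1 + 2 ^ (-s)` cancels the even
terms and leaves the odd ones. -/
theorem LSeries_twoSign_eq {s : ℂ} (hs : 1 < s.re) : LSeries twoSign s = zetaTwist (-1) s := by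
  have hA : HasSum (term twoSign s) (LSeries twoSign s) :=
    (LSeriesSummable_twoSign hs).LSeriesHasSum
  have heven : HasSum (fun n : ℕ => if Even n then 2 ^ (-s) * term twoSign s (n / 2) else 0)
      (2 ^ (-s) * LSeries twoSign s) := by
    refine (Function.Injective.hasSum_iff (g := fun k : ℕ => 2 * k)
      (fun a b h => by simpa using h) fun n hn => ?_).1 ?_
    · rw [if_neg]
      rintro ⟨k, hk⟩
      exact hn ⟨k, by simp only; omega⟩
    · convert! hA.mul_left ((2 : ℂ) ^ (-s)) using 2 with k
      simp
  have hodd : LSeries ((1 : DirichletCharacter ℂ 2) ·) s = LSeries twoSign s +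
      2 ^ (-s) * LSeries twoSign s := by
    suffices hfun : term ((1 : DirichletCharacter ℂ 2) ·) s = fun n => term twoSign s n +
        if Even n then 2 ^ (-s) * term twoSign s (n / 2) else 0 by
      rw [LSeries, hfun]; exact (hA.add heven).tsum_eq
    ext n
    rcases Nat.eq_zero_or_pos n with rfl | hn
    · simp
    rw [term_of_ne_zero hn.ne', term_of_ne_zero hn.ne', trivChar_two_apply]
    by_cases h : Even n
    · obtain ⟨m, rfl⟩ := even_iff_two_dvd.1 h
      have hm : m ≠ 0 := by omega
      rw [if_pos h, if_pos h, twoSign_mul two_ne_zero hm, twoSign_prime Nat.prime_two, if_pos rfl,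
        Nat.mul_div_cancel_left _ two_pos, term_of_ne_zero hm, Nat.cast_mul,
        Complex.natCast_mul_natCast_cpow, Complex.cpow_neg]
      push_cast
      field_simp
      ring
    · rw [if_neg h, if_neg h, twoSign_odd h, add_zero]
  have hne := one_sub_mul_two_cpow_ne_zero (c := -1) (by simp) hs
  rw [zetaTwist, eq_div_iff hne, oddZeta_eq_LSeries hs, hodd]
  ring

theorem norm_natCast_cpow_mul_I {n : ℕ} (hn : n ≠ 0) (t : ℝ) :
    ‖(n : ℂ) ^ (-(t * Complex.I))‖ = 1 := by
  have := Complex.norm_natCast_cpow_of_pos (Nat.pos_of_ne_zero hn) (-(t * Complex.I))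
  simpa using this

/-- The vertical translates of `ζ` approximate `zetaTwist (-1)` uniformly on `2 ≤ re s`. -/
theorem exists_shift_zeta_approx {κ : ℝ} (hκ : 0 < κ) : ∃ T : ℝ,
    ‖(2 : ℂ) ^ (-(T * Complex.I)) + 1‖ < κ ∧
    ∀ s : ℂ, 2 ≤ s.re → ‖riemannZeta (s + T * Complex.I) - zetaTwist (-1) s‖ < κ := by
  obtain ⟨T, hT⟩ := exists_shift_tendsto_twoSign
  have h2 : ∀ᶠ k in atTop, ‖(2 : ℂ) ^ (-(T k * Complex.I)) + 1‖ < κ := by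
    have := hT 2 two_ne_zero
    rw [twoSign_prime Nat.prime_two, if_pos rfl, tendsto_iff_norm_sub_tendsto_zero] at this
    simpa using this.eventually (gt_mem_nhds hκ)
  -- A majorant of the `n`-th term of the difference, independent of `s` on `2 ≤ re s`; dominated
  -- convergence then yields a uniform estimate.
  let B : ℕ → ℕ → ℝ := fun k n =>
    ‖(n : ℂ) ^ (-(T k * Complex.I)) - twoSign n‖ * (1 / (n : ℝ) ^ 2)
  have hBle (k n : ℕ) : ‖B k n‖ ≤ 2 * (1 / (n : ℝ) ^ 2) := by
    rcases eq_or_ne n 0 with rfl | hn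
    · simp [B]
    rw [Real.norm_of_nonneg (by positivity)]
    refine mul_le_mul_of_nonneg_right ((norm_sub_le _ _).trans ?_) (by positivity)
    rw [norm_natCast_cpow_mul_I hn, norm_twoSign]; norm_num
  have hsb : Summable fun n : ℕ => 2 * (1 / (n : ℝ) ^ 2) := hasSum_zeta_two.summable.mul_left 2
  have hBs (k : ℕ) : Summable (B k) := hsb.of_norm_bounded (hBle k)
  have hlim : Tendsto (fun k => ∑' n, B k n) atTop (𝓝 0) := by
    rw [show (0 : ℝ) = ∑' n : ℕ, (0 : ℝ) by simp]
    refine tendsto_tsum_of_dominated_convergence hsb (fun n => ?_)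
      (Eventually.of_forall fun k n => hBle k n)
    rcases eq_or_ne n 0 with rfl | hn
    · simp [B]
    · have := (tendsto_iff_norm_sub_tendsto_zero.1 (hT n hn)).mul_const (1 / (n : ℝ) ^ 2)
      simpa [B] using this
  obtain ⟨k, hk2, hk⟩ := (h2.and (hlim.eventually (gt_mem_nhds hκ))).exists
  refine ⟨T k, hk2, fun s hs => lt_of_le_of_lt ?_ hk⟩
  have hs1 : 1 < s.re := by linarith
  have hz : HasSum (term 1 (s + T k * Complex.I)) (riemannZeta (s + T k * Complex.I)) :=
    LSeriesHasSum_one (by simpa using hs1)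
  have hg : HasSum (term twoSign s) (zetaTwist (-1) s) := by
    rw [← LSeries_twoSign_eq hs1]; exact (LSeriesSummable_twoSign hs1).LSeriesHasSum
  rw [← (hz.sub hg).tsum_eq]
  refine tsum_of_norm_bounded (hBs k).hasSum fun n => ?_
  rcases eq_or_ne n 0 with rfl | hn
  · simp [B]
  have hn0 : (n : ℂ) ≠ 0 := by exact_mod_cast hn
  have hn1 : (1 : ℝ) ≤ n := by exact_mod_cast Nat.one_le_iff_ne_zero.2 hn
  have heq : term 1 (s + T k * Complex.I) n - term twoSign s n =
      ((n : ℂ) ^ (-(T k * Complex.I)) - twoSign n) * (n : ℂ) ^ (-s) := by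
    rw [term_of_ne_zero hn, term_of_ne_zero hn, Complex.cpow_add _ _ hn0, Complex.cpow_neg,
      Complex.cpow_neg, Pi.one_apply]
    have h3 : (n : ℂ) ^ s ≠ 0 := by simp [Complex.cpow_eq_zero_iff, hn]
    have h4 : (n : ℂ) ^ (T k * Complex.I) ≠ 0 := by simp [Complex.cpow_eq_zero_iff, hn]
    field_simp
  rw [heq, norm_mul]
  refine mul_le_mul_of_nonneg_left ?_ (norm_nonneg _)
  rw [Complex.norm_natCast_cpow_of_pos (Nat.pos_of_ne_zero hn), Complex.neg_re]
  calc (n : ℝ) ^ (-s.re) ≤ (n : ℝ) ^ (-2 : ℝ) :=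
        Real.rpow_le_rpow_of_exponent_le hn1 (by linarith)
    _ = _ := by rw [Real.rpow_neg (by linarith), one_div]; norm_cast

theorem riemannZeta_re_pos_of_two_le {s : ℂ} (hs : 2 ≤ s.re) : 0 < (riemannZeta s).re := by
  have hz : HasSum (term 1 s) (riemannZeta s) := LSeriesHasSum_one (by linarith)
  have h1 : HasSum (fun n : ℕ => if n = 1 then (1 : ℂ) else 0) 1 := hasSum_ite_eq 1 1
  have h2 : HasSum (fun n : ℕ => if n = 1 then (1 : ℝ) else 0) 1 := hasSum_ite_eq 1 1
  have hb : ‖riemannZeta s - 1‖ ≤ Real.pi ^ 2 / 6 - 1 := by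
    rw [← (hz.sub h1).tsum_eq]
    refine tsum_of_norm_bounded (hasSum_zeta_two.sub h2) fun n => ?_
    rcases Nat.eq_zero_or_pos n with rfl | hn
    · simp
    rcases eq_or_ne n 1 with rfl | hn1
    · simp
    · have h3 : (1 : ℝ) ≤ n := by exact_mod_cast hn
      rw [term_of_ne_zero hn.ne', if_neg hn1, if_neg hn1, sub_zero, sub_zero, norm_div,
        Complex.norm_natCast_cpow_of_pos hn, Pi.one_apply, norm_one]
      gcongr
      calc (n : ℝ) ^ 2 = (n : ℝ) ^ (2 : ℝ) := by norm_cast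
        _ ≤ _ := Real.rpow_le_rpow_of_exponent_le h3 hs
  have hpi : Real.pi ^ 2 ≤ 3.15 ^ 2 := pow_le_pow_left₀ Real.pi_pos.le Real.pi_lt_d2.le 2
  have h4 := (Complex.abs_re_le_norm _).trans hb
  rw [Complex.sub_re, Complex.one_re] at h4
  have := (abs_le.1 h4).1
  norm_num at hpi
  linarith

end Shifts

/-! ### Turning points: the bound by E and the approach to E -/

section TurningPoints

/-- The real part of minus the logarithmic derivative of `zetaTwist c`. -/
noncomputable def twistRe (c s : ℂ) : ℝ :=
  (oddLogDeriv s).re + Real.log 2 * (c * 2 ^ (-s) / (1 - c * 2 ^ (-s))).re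

theorem re_deriv_zetaTwist {c s : ℂ} (him : (zetaTwist c s).im = 0) :
    (-(oddLogDeriv s + Real.log 2 * (c * 2 ^ (-s) / (1 - c * 2 ^ (-s)))) * zetaTwist c s).re =
      -twistRe c s * (zetaTwist c s).re := by
  rw [Complex.mul_re, him, mul_zero, sub_zero, Complex.neg_re, Complex.add_re,
    Complex.re_ofReal_mul, twistRe]

theorem abs_re_oddLogDeriv_lt_of_le_re {E : ℝ} (hE : 5 / 2 < E) (hEq : titchmarshFun E = Real.log 2)
    {c s : ℂ} (hc : ‖c‖ = 1) (hs : E ≤ s.re) (ht : s.im ≠ 0) (him : (zetaTwist c s).im = 0) :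
    |(oddLogDeriv s).re| < Real.log 2 * |(c * 2 ^ (-s) / (1 - c * 2 ^ (-s))).re| := by
  have hd : oddLogDerivReal s.re ≤ Real.log 2 * (2 ^ (-s.re) / (1 + 2 ^ (-s.re))) := by
    rw [oddLogDerivReal_le_iff, ← hEq]
    exact titchmarshFun_strictAntiOn.antitoneOn (Set.mem_Ioi.2 (by linarith))
      (Set.mem_Ioi.2 (by linarith)) hs
  have := abs_re_oddLogDeriv_lt_of_im_eq_zero (by linarith) ht hd hc
    (by rw [Complex.re_add_im]; exact him)
  rwa [Complex.re_add_im] at this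

/-- Off the real axis the key inequality forbids cancellation of the two real parts; on it both are
nonnegative and the Euler term is positive. -/
theorem IsZetaTurningPoint.re_lt {E : ℝ} (hE : 5 / 2 < E) (hEq : titchmarshFun E = Real.log 2)
    {b : ℂ} (hb : IsZetaTurningPoint b) : b.re < E := by
  by_contra! hle
  have hs : 1 < b.re := by linarith
  obtain ⟨-, him, hre⟩ := hb
  have hne := riemannZeta_ne_zero_of_one_lt_re hs
  have hz := zetaTwist_one hs
  have him' : (zetaTwist 1 b).im = 0 := by rw [hz, him]
  have hre0 : (zetaTwist 1 b).re ≠ 0 := fun h => hne (by rw [← hz]; exact Complex.ext h him')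
  have hcrit : twistRe 1 b = 0 := by
    rw [(hasDerivAt_riemannZeta hs).deriv, ← hz, re_deriv_zetaTwist him', mul_eq_zero,
      or_iff_left hre0, neg_eq_zero] at hre
    exact hre
  rw [twistRe] at hcrit
  have hl2 : 0 < Real.log 2 := Real.log_pos one_lt_two
  rcases eq_or_ne b.im 0 with h0 | h0
  · have hb : b = (b.re : ℂ) := Complex.ext rfl (by simpa using h0)
    have h1 := eulerTerm_ofReal 1 b.re
    rw [Complex.ofReal_one, ← hb] at h1
    rw [h1, Complex.ofReal_re, hb, oddLogDeriv_ofReal hs, Complex.ofReal_re, Complex.ofReal_re] at hcrit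
    have h2 := oddLogDerivReal_nonneg b.re
    have h3 := two_rpow_neg_lt_half hs
    have h4 := Real.rpow_pos_of_pos two_pos (-b.re)
    have h5 : 0 < (1 : ℝ) * 2 ^ (-b.re) / (1 - 1 * 2 ^ (-b.re)) := div_pos (by linarith) (by linarith)
    have := mul_pos hl2 h5
    linarith
  · have hlt := abs_re_oddLogDeriv_lt_of_le_re hE hEq (c := 1) (by simp) hle h0 him'
    rw [eq_neg_of_add_eq_zero_left hcrit, abs_neg, abs_mul, abs_of_pos hl2] at hlt
    exact lt_irrefl _ hlt

/-- If the imaginary part vanished on an interval, so would its vertical derivative, against the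
strict key inequality. This supplies the heights of the horizontal sides of the box. -/
theorem exists_im_zetaTwist_ne_zero {E : ℝ} (hE : 5 / 2 < E) (hEq : titchmarshFun E = Real.log 2)
    {x y : ℝ} (hxy : x < y) (h0 : (0 : ℝ) ∉ Set.Ioo x y) :
    ∃ τ ∈ Set.Ioo x y, (zetaTwist (-1) (E + τ * Complex.I)).im ≠ 0 := by
  by_contra! hcon
  obtain ⟨τ, hτ⟩ := exists_between hxy
  have hs : 1 < (E + τ * Complex.I : ℂ).re := by simp; linarith
  have him := hcon τ hτ
  have hder := hasDerivAt_im_vertical (hasDerivAt_zetaTwist (c := -1) (by simp) hs)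
  have hconst : HasDerivAt (fun y : ℝ => (zetaTwist (-1) (E + y * Complex.I)).im) 0 τ :=
    (hasDerivAt_const τ (0 : ℝ)).congr_of_eventuallyEq (by
      filter_upwards [Ioo_mem_nhds hτ.1 hτ.2] with u hu using hcon u hu)
  have hre := hder.unique hconst
  have hre0 : (zetaTwist (-1) (E + τ * Complex.I)).re ≠ 0 := fun h =>
    zetaTwist_ne_zero (by simp) hs (Complex.ext h him)
  rw [re_deriv_zetaTwist him, mul_eq_zero, or_iff_left hre0, neg_eq_zero, twistRe] at hre
  have hlt := abs_re_oddLogDeriv_lt_of_le_re hE hEq (c := -1) (s := E + τ * Complex.I) (by simp) (by simp)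
    (by simp; rintro rfl; exact h0 hτ) him
  have hl2 : 0 < Real.log 2 := Real.log_pos one_lt_two
  rw [eq_neg_of_add_eq_zero_left hre, abs_neg, abs_mul, abs_of_pos hl2] at hlt
  exact lt_irrefl _ hlt

/-- To the left of the Titchmarsh constant `zetaTwist (-1)` decreases along vertical segments
crossing the real axis. -/
theorem exists_crossing_zetaTwist {E a κ : ℝ} (hE : titchmarshFun E = Real.log 2) (ha : 1 < a)
    (haE : a < E) (hκ : 0 < κ) : ∃ η ∈ Set.Ioo 0 κ,
      0 < (zetaTwist (-1) (a + (-η : ℝ) * Complex.I)).im ∧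
      (zetaTwist (-1) (a + η * Complex.I)).im < 0 := by
  have hs : 1 < (a + (0 : ℝ) * Complex.I : ℂ).re := by simpa using ha
  have hsa : (a + (0 : ℝ) * Complex.I : ℂ) = a := by simp
  have hr := Real.rpow_pos_of_pos two_pos (-a)
  have hr2 := two_rpow_neg_lt_half ha
  have hval : zetaTwist (-1) a = (((1 - 2 ^ (-a)) * (riemannZeta a).re / (1 + 2 ^ (-a)) : ℝ) : ℂ) := by
    have hζ : riemannZeta a = ((riemannZeta a).re : ℂ) :=
      Complex.ext rfl (by simpa using riemannZeta_im_eq_zero_of_one_lt ha)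
    rw [zetaTwist, oddZeta, hζ]
    push_cast
    rw [Complex.ofReal_cpow two_pos.le, Complex.ofReal_re]
    push_cast
    ring
  have him : (zetaTwist (-1) (a + (0 : ℝ) * Complex.I)).im = 0 := by
    rw [hsa, hval, Complex.ofReal_im]
  have hpos : 0 < (zetaTwist (-1) (a + (0 : ℝ) * Complex.I)).re := by
    rw [hsa, hval, Complex.ofReal_re]
    exact div_pos (mul_pos (by linarith) (riemannZeta_re_pos_of_one_lt ha)) (by linarith)
  have hder := hasDerivAt_im_vertical (hasDerivAt_zetaTwist (c := -1) (by simp) hs)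
  rw [re_deriv_zetaTwist him] at hder
  have htw : 0 < twistRe (-1) (a + (0 : ℝ) * Complex.I) := by
    have h1 := eulerTerm_ofReal (-1) a
    rw [Complex.ofReal_neg, Complex.ofReal_one] at h1
    rw [hsa, twistRe, h1, oddLogDeriv_ofReal ha, Complex.ofReal_re, Complex.ofReal_re]
    -- At a real point the twisted Euler term takes its extreme value `-r / (1 + r)`; left of `E` it
    -- is too small to outweigh `oddLogDerivReal a`.
    have h2 : ¬ oddLogDerivReal a ≤ Real.log 2 * (2 ^ (-a) / (1 + 2 ^ (-a))) := by
      rw [oddLogDerivReal_le_iff, ← hE, not_le]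
      exact titchmarshFun_strictAntiOn ha (ha.trans haE) haE
    rw [show (-1 * 2 ^ (-a) / (1 - -1 * 2 ^ (-a)) : ℝ) = -(2 ^ (-a) / (1 + 2 ^ (-a))) by ring]
    linarith
  obtain ⟨η, ⟨h1, h2⟩, hη⟩ := ((eventually_pos_and_neg_of_deriv_neg hder him
    (by nlinarith)).and (Ioo_mem_nhdsGT hκ)).exists
  refine ⟨η, hη, ?_, ?_⟩
  · simpa using h1
  · simpa using h2

theorem re_two_cpow_neg_lt_zero {z : ℂ} (hz : ‖(2 : ℂ) ^ (-(z.im * Complex.I)) + 1‖ < 1) :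
    ((2 : ℂ) ^ (-z)).re < 0 := by
  have h1 : (2 : ℂ) ^ (-z) = ((2 ^ (-z.re) : ℝ) : ℂ) * 2 ^ (-(z.im * Complex.I)) := by
    conv_lhs => rw [← Complex.re_add_im z, neg_add, Complex.cpow_add _ _ two_ne_zero]
    rw [Complex.ofReal_cpow two_pos.le]
    push_cast
    rfl
  rw [h1, Complex.re_ofReal_mul]
  have h2 := (Complex.re_le_norm _).trans_lt hz
  rw [Complex.add_re, Complex.one_re] at h2
  exact mul_neg_of_pos_of_neg (Real.rpow_pos_of_pos two_pos _) (by linarith)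

theorem norm_two_cpow_sub_one_le (τ : ℝ) : ‖(2 : ℂ) ^ (-(τ * Complex.I)) - 1‖ ≤ |τ| := by
  have h1 : (2 : ℂ) ^ (-(τ * Complex.I)) = Complex.exp (Complex.I * ((-(Real.log 2 * τ) : ℝ) : ℂ)) := by
    rw [Complex.cpow_def_of_ne_zero two_ne_zero]
    rw [Complex.ofReal_neg, Complex.ofReal_mul, Complex.ofReal_log two_pos.le, Complex.ofReal_ofNat]
    congr 1
    ring
  rw [h1]
  refine Real.norm_exp_I_mul_ofReal_sub_one_le.trans ?_
  rw [Real.norm_eq_abs, abs_neg, abs_mul, abs_of_pos (Real.log_pos one_lt_two)]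
  have := Real.log_two_lt_d9
  have := abs_nonneg τ
  nlinarith

/-- Zeros of `Im ζ` beyond the Titchmarsh constant and with `2 ^ (-i im s)` close to `-1` are
increasing in the vertical direction. -/
theorem re_deriv_riemannZeta_pos {E : ℝ} (hE : 5 / 2 < E) (hEq : titchmarshFun E = Real.log 2)
    {s : ℂ} (hs : E ≤ s.re) (h2 : ‖(2 : ℂ) ^ (-(s.im * Complex.I)) + 1‖ < 1)
    (him : (riemannZeta s).im = 0) : 0 < (deriv riemannZeta s).re := by
  have hs1 : 1 < s.re := by linarith
  -- On the real axis the norm in `h2` would equal 2.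
  have ht : s.im ≠ 0 := fun h => by norm_num [h] at h2
  have hz := zetaTwist_one hs1
  have him' : (zetaTwist 1 s).im = 0 := by rw [hz, him]
  rw [(hasDerivAt_riemannZeta hs1).deriv, ← hz, re_deriv_zetaTwist him', hz]
  refine mul_pos ?_ (riemannZeta_re_pos_of_two_le (by linarith))
  have hlt := abs_re_oddLogDeriv_lt_of_le_re hE hEq (c := 1) (by simp) hs ht him'
  have hneg : (1 * 2 ^ (-s) / (1 - 1 * 2 ^ (-s)) : ℂ).re < 0 := by
    rw [re_div_one_sub]
    refine div_neg_of_neg_of_pos ?_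
      (Complex.normSq_pos.2 (one_sub_mul_two_cpow_ne_zero (by simp) hs1))
    rw [one_mul]
    linarith [re_two_cpow_neg_lt_zero h2, Complex.normSq_nonneg ((2 : ℂ) ^ (-s))]
  rw [abs_of_neg hneg] at hlt
  have := (abs_lt.1 hlt).2
  rw [twistRe]
  linarith

theorem continuousAt_im_zetaTwist {σ : ℝ} (hσ : 1 < σ) (τ : ℝ) :
    ContinuousAt (fun x : ℝ => (zetaTwist (-1) (x + τ * Complex.I)).im) σ := by
  have h1 : ContinuousAt (zetaTwist (-1)) (σ + τ * Complex.I) :=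
    (hasDerivAt_zetaTwist (by simp) (by simpa using hσ)).continuousAt
  have h2 : ContinuousAt (fun x : ℝ => (x + τ * Complex.I : ℂ)) σ := by fun_prop
  exact Complex.continuous_im.continuousAt.comp
    (ContinuousAt.comp (f := fun x : ℝ => (x + τ * Complex.I : ℂ)) h1 h2)

/-- The fold lemma is applied to `ζ(s + iT)` on a thin box `[a, E] × [p, q]` around the real point
`E`. -/
theorem exists_turningPoint_near {E : ℝ} (hE : 5 / 2 < E) (hEq : titchmarshFun E = Real.log 2)
    {ε : ℝ} (hε : 0 < ε) : ∃ b : ℂ, IsZetaTurningPoint b ∧ E - ε ≤ b.re := by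
  obtain ⟨p, hp, hpE⟩ := exists_im_zetaTwist_ne_zero hE hEq (x := -(1 / 4)) (y := 0) (by norm_num)
    (by simp)
  obtain ⟨q, hq, hqE⟩ := exists_im_zetaTwist_ne_zero hE hEq (x := 0) (y := 1 / 4) (by norm_num)
    (by simp)
  have hE1 : 1 < E := by linarith
  obtain ⟨l, hl, hsub⟩ := exists_Ioc_subset_of_mem_nhds
    (((continuousAt_im_zetaTwist hE1 p).eventually_ne hpE).and
      ((continuousAt_im_zetaTwist hE1 q).eventually_ne hqE)) ⟨E - 1, by linarith⟩
  obtain ⟨a, ha, haE⟩ := exists_between (max_lt hl (max_lt hE (sub_lt_self E hε)))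
  have hal : l < a := (le_max_left _ _).trans_lt ha
  have ha5 : 5 / 2 < a := ((le_max_left _ _).trans (le_max_right _ _)).trans_lt ha
  have haε : E - ε < a := ((le_max_right _ _).trans (le_max_right _ _)).trans_lt ha
  have hlow (τ : ℝ) (hτ : ∀ σ ∈ Set.Icc a E, (zetaTwist (-1) (σ + τ * Complex.I)).im ≠ 0) :
      ∃ m > 0, ∀ σ ∈ Set.Icc a E, m ≤ |(zetaTwist (-1) (σ + τ * Complex.I)).im| := by
    obtain ⟨σ₀, hσ₀, hmin⟩ := isCompact_Icc.exists_isMinOn (Set.nonempty_Icc.2 haE.le)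
      (f := fun σ : ℝ => |(zetaTwist (-1) (σ + τ * Complex.I)).im|) (fun σ hσ =>
        (continuous_abs.continuousAt.comp
          (continuousAt_im_zetaTwist (by linarith [hσ.1]) τ)).continuousWithinAt)
    exact ⟨_, abs_pos.2 (hτ σ₀ hσ₀), fun σ hσ => hmin hσ⟩
  obtain ⟨m₁, hm₁, hm₁'⟩ := hlow p fun σ hσ => (hsub ⟨hal.trans_le hσ.1, hσ.2⟩).1
  obtain ⟨m₂, hm₂, hm₂'⟩ := hlow q fun σ hσ => (hsub ⟨hal.trans_le hσ.1, hσ.2⟩).2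
  obtain ⟨η, hη, hη1, hη2⟩ := exists_crossing_zetaTwist hEq (a := a) (by linarith) haE
    (κ := min (-p) q) (lt_min (by linarith [hp.2]) hq.1)
  have hηp := hη.2.trans_le (min_le_left _ _)
  have hηq := hη.2.trans_le (min_le_right _ _)
  -- An approximation within `κ` preserves nonvanishing on the horizontal sides and both signs on
  -- the left side. The cap `1 / 4`, together with `|τ| ≤ 1 / 4`, keeps `2 ^ (-i(τ + T))` within
  -- distance 1 of `-1` on the right side.
  set κ := min (min m₁ m₂) (min (min (zetaTwist (-1) (a + (-η : ℝ) * Complex.I)).im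
    (-(zetaTwist (-1) (a + η * Complex.I)).im)) (1 / 4)) with hκ
  have hκ0 : 0 < κ :=
    lt_min (lt_min hm₁ hm₂) (lt_min (lt_min hη1 (neg_pos.2 hη2)) (by norm_num))
  have hκ1 : κ ≤ m₁ := (min_le_left _ _).trans (min_le_left _ _)
  have hκ2 : κ ≤ m₂ := (min_le_left _ _).trans (min_le_right _ _)
  have hκ3 : κ ≤ (zetaTwist (-1) (a + (-η : ℝ) * Complex.I)).im :=
    ((min_le_right _ _).trans (min_le_left _ _)).trans (min_le_left _ _)
  have hκ4 : κ ≤ -(zetaTwist (-1) (a + η * Complex.I)).im :=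
    ((min_le_right _ _).trans (min_le_left _ _)).trans (min_le_right _ _)
  have hκ5 : κ ≤ 1 / 4 := (min_le_right _ _).trans (min_le_right _ _)
  obtain ⟨T, hT2, hT⟩ := exists_shift_zeta_approx hκ0
  have happ (σ τ : ℝ) (hσ : a ≤ σ) : |(riemannZeta (σ + τ * Complex.I + T * Complex.I)).im -
      (zetaTwist (-1) (σ + τ * Complex.I)).im| < κ := by
    rw [← Complex.sub_im]
    exact (Complex.abs_im_le_norm _).trans_lt (hT _ (by simp; linarith))
  have hne1 {s : ℂ} (hs : 1 < s.re) : s ≠ 1 := by rintro rfl; simp at hs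
  have hshift {s : ℂ} (hs : s.re ∈ Set.Icc a E) : 1 < (s + T * Complex.I).re := by
    have := hs.1; simp; linarith
  have hedge (τ m : ℝ) (hκm : κ ≤ m)
      (hm : ∀ σ ∈ Set.Icc a E, m ≤ |(zetaTwist (-1) (σ + τ * Complex.I)).im|) (σ : ℝ)
      (hσ : σ ∈ Set.Icc a E) : (riemannZeta (σ + τ * Complex.I + T * Complex.I)).im ≠ 0 := by
    intro h
    have h1 := happ σ τ hσ.1
    rw [h, zero_sub, abs_neg] at h1
    linarith [hm σ hσ]
  obtain ⟨b, hab, him, hre, hbE, -⟩ := exists_im_eq_zero_re_deriv_eq_zero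
    (f := fun s => riemannZeta (s + T * Complex.I))
    (f' := fun s => deriv riemannZeta (s + T * Complex.I)) (p := p) (q := q) haE.le
    (fun s hs _ => (hasDerivAt_riemannZeta (hshift hs)).differentiableAt.hasDerivAt.comp_add_const
      s (T * Complex.I))
    (fun s hs => by
      have h1 : DifferentiableOn ℂ riemannZeta {s | 1 < s.re} := fun z hz =>
        (hasDerivAt_riemannZeta hz).differentiableAt.differentiableWithinAt
      have h2 : ContinuousAt (deriv riemannZeta) (s + T * Complex.I) :=
        ((h1.deriv isOpen_one_lt_re).differentiableAt
          (isOpen_one_lt_re.mem_nhds (hshift hs.1))).continuousAt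
      exact (ContinuousAt.comp (f := fun s : ℂ => s + T * Complex.I) h2
        (by fun_prop)).continuousWithinAt)
    (hedge p m₁ hκ1 hm₁') (hedge q m₂ hκ2 hm₂')
    (fun τ hτ h => by
      refine re_deriv_riemannZeta_pos hE hEq (by simp) ?_ h
      have h1 : ((E + τ * Complex.I + T * Complex.I : ℂ).im : ℂ) * Complex.I =
          τ * Complex.I + T * Complex.I := by simp; ring
      rw [h1, neg_add, Complex.cpow_add _ _ two_ne_zero]
      have hτ4 : |τ| ≤ 1 / 4 := abs_le.2 ⟨by linarith [hp.1, hτ.1], by linarith [hq.2, hτ.2]⟩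
      have h3 := norm_two_cpow_sub_one_le τ
      have h4 : ‖(2 : ℂ) ^ (-(T * Complex.I))‖ = 1 := by
        have := norm_natCast_cpow_mul_I two_ne_zero T
        exact_mod_cast this
      calc ‖(2 : ℂ) ^ (-(τ * Complex.I)) * 2 ^ (-(T * Complex.I)) + 1‖
          = ‖((2 : ℂ) ^ (-(τ * Complex.I)) - 1) * 2 ^ (-(T * Complex.I)) +
            (2 ^ (-(T * Complex.I)) + 1)‖ := by congr 1; ring
        _ ≤ ‖(2 : ℂ) ^ (-(τ * Complex.I)) - 1‖ * 1 + ‖(2 : ℂ) ^ (-(T * Complex.I)) + 1‖ := by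
            rw [← h4, ← norm_mul]; exact norm_add_le _ _
        _ < 1 := by linarith)
    ⟨-η, ⟨by linarith, by linarith [hη.1, hq.1]⟩, η, ⟨by linarith [hη.1, hp.2], hηq.le⟩,
      by linarith [hη.1],
      by have := (abs_lt.1 (happ a (-η) le_rfl)).1; linarith,
      by have := (abs_lt.1 (happ a η le_rfl)).2; linarith⟩
  refine ⟨b + T * Complex.I, ⟨hne1 (hshift hbE), him, hre⟩, ?_⟩
  simp
  linarith

end TurningPoints

theorem theorem9p1 :
    ∃ E : ℝ,
      (IsTitchmarshSolution E ∧ ∀ σ : ℝ, IsTitchmarshSolution σ → σ = E) ∧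
      (∀ b : ℂ, IsZetaTurningPoint b → b.re < E) ∧
      ∃ b : ℕ → ℂ, (∀ k, IsZetaTurningPoint (b k)) ∧
        Tendsto (fun k => (b k).re) atTop (𝓝 E) := by
  obtain ⟨E, hE, hEq⟩ := exists_titchmarsh_constant
  have hE1 : 1 < E := by linarith
  refine ⟨E, ⟨(isTitchmarshSolution_iff E).2 ⟨hE1, hEq⟩, fun σ hσ => ?_⟩,
    fun b hb => hb.re_lt hE hEq, ?_⟩
  · obtain ⟨hσ1, hσ2⟩ := (isTitchmarshSolution_iff σ).1 hσ
    exact titchmarshFun_strictAntiOn.injOn hσ1 hE1 (hσ2.trans hEq.symm)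
  · choose b hb hbE using fun k : ℕ => exists_turningPoint_near hE hEq
      (ε := 1 / ((k : ℝ) + 1)) (by positivity)
    refine ⟨b, hb, tendsto_of_tendsto_of_tendsto_of_le_of_le ?_ tendsto_const_nhds hbE
      fun k => ((hb k).re_lt hE hEq).le⟩
    simpa using tendsto_one_div_add_atTop_nhds_zero_nat.const_sub E
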